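/- Let $k$ be an algebraically closed field of characteristic $0$ and let $X=X_\Sigma$ be the toric variety over $k$ of a fan $\Sigma$ in $N_{\mathbb R}$, where $M$ is the character lattice, $N=\operatorname{Hom}(M,\mathbb Z)$, and $\langle\cdot,\cdot\rangle$ is the pairing. Let $K$ be the function field of $X$. For a ray $\rho\in\Sigma(1)$, which we identify with its primitive generator in $N$, let $D_\rho$ be the corresponding torus invariant prime divisor, and let $\operatorname{Div}_T(X)=\mathbb Z^{\Sigma(1)}$ be the lattice of torus invariant divisors. For a prime divisor $P$ and $f\in K$ let $f(P)\in\kappa(P)\cup\{\infty\}$ be the value of $f$ at the generic point of $P$ (with $\kappa(P)$ the residue field there), and put $\operatorname{ord}_P(0)=\infty$. A pre-Weil decoration of a finite-dimensional $K$-vector space $\mathcal V$ is a map $\mathcal W\colon\mathcal V\to\operatorname{Div}(X)\cup\{\infty\}$ such that $\mathcal W(v)=\infty$ if and only if $v=0$, $\mathcal W(fv)=\operatorname{div}(f)+\mathcal W(v)$ for $f\in K$, and $\mathcal W(v+v')\ge\mathcal W(v)\wedge\mathcal W(v')$ (coefficientwise minimum). Its associated sheaf is $\mathcal O_X(\mathcal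 W)(U)=\{v\in\mathcal V : \mathcal W(v)|_U\ge 0\}$ for non-empty open $U\subseteq X$. It is called a Weil decoration if it is coherent, i.e. if $\mathcal O_X(\mathcal W)$ is a coherent sheaf. Theorem. (i) Let $h$ be an assignment which associates with every ray $\rho\in\Sigma(1)$ a unit $h(\rho)\in\kappa(D_\rho)^*$. Then the assignment $\mathcal W_h$ on $K^2$ with $\mathcal W_h(0,0)=\infty$ and, for every prime divisor $P$ of $X$, with coefficient $$\mathcal W_h(f,g)_P=\begin{cases}\min\{\operatorname{ord}_P(f),\operatorname{ord}_P(g)\}+1&\text{if }P=D_\rho\text{ for some }\rho\in\Sigma(1)\text{ and }(f/g)(D_\rho)=h(\rho),\\ \min\{\operatorname{ord}_P(f),\operatorname{ord}_P(g)\}&\text{otherwise,}\end{cases}$$ is a Weil decoration, and its associated sheaf $\mathcal O_X(\mathcal W_h)$ is a reflexive sheaf of rank two. (ii) Let $u\colon\operatorname{Div}_T(X)\to M$ be a $\mathbb Z$-linear map such that $u_\rho:=u(D_\rho)$ satisfies $\langle u_\rho,\rho\rangle=0$ for every $\rho\in\Sigma(1)$. Then the assignment $\mathcal W_u$ on $K^2$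 with $\mathcal W_u(0,0)=\infty$ and, for every prime divisor $P$ of $X$, with coefficient $$\mathcal W_u(f,g)_P=\begin{cases}\min\{\operatorname{ord}_P(f),\operatorname{ord}_P(g)\}+1&\text{if }P=D_\rho\text{ for some }\rho\in\Sigma(1)\text{ and }(f/g)(D_\rho)=x^{u_\rho}(D_\rho),\\ \min\{\operatorname{ord}_P(f),\operatorname{ord}_P(g)\}&\text{otherwise,}\end{cases}$$ is a Weil decoration, and its associated sheaf $\mathcal{HM}_X(u):=\mathcal O_X(\mathcal W_u)$ is a reflexive sheaf of rank two. -/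

import Mathlib

open AlgebraicGeometry CategoryTheory Opposite TopologicalSpace

universe u

namespace WeilDeco

noncomputable section

section Dual
variable {X : Scheme.{u}}

instance presheafModule (P : X.PresheafOfModules) (U : X.Opensᵒᵖ) :
    Module (X.presheaf.obj U) (P.obj U) := (P.obj U).isModule

/-- A section over `U` of the dual `ℋom(P, 𝒪_X)` of a presheaf of modules: a morphism
`P|_U → 𝒪_X|_U`, that is, linear maps `P(V) → 𝒪_X(V)` for all open `V ⊆ U` that commute with
restriction. -/
@[ext]
structure DualSection (P : X.PresheafOfModules) (U : X.Opens) : Type u where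
  app : ∀ V : X.Opens, V ≤ U → (P.obj (op V) →ₗ[X.presheaf.obj (op V)] X.presheaf.obj (op V))
  compat : ∀ (V W : X.Opens) (hV : V ≤ U) (h : W ≤ V) (s : P.obj (op V)),
    X.presheaf.map (homOfLE h).op (app V hV s) =
      app W (h.trans hV) (P.restrictₛₗ (homOfLE h).op s)

variable {P : X.PresheafOfModules} {U V : X.Opens}
namespace DualSection

instance : Zero (DualSection P U) := ⟨⟨fun _ _ => 0, fun _ _ _ _ _ => map_zero _⟩⟩
instance : Add (DualSection P U) :=
  ⟨fun φ ψ => ⟨fun V h => φ.app V h + ψ.app V h, fun V W hV h s =>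
    (map_add _ _ _).trans (congrArg₂ (· + ·) (φ.compat V W hV h s) (ψ.compat V W hV h s))⟩⟩
instance : Neg (DualSection P U) :=
  ⟨fun φ => ⟨fun V h => - φ.app V h, fun V W hV h s =>
    (map_neg _ _).trans (congrArg (- ·) (φ.compat V W hV h s))⟩⟩
instance : SMul Γ(X, U) (DualSection P U) :=
  ⟨fun a φ => ⟨fun V h => X.presheaf.map (homOfLE h).op a • φ.app V h, by
    intro V W hV h s
    simp only [LinearMap.smul_apply, smul_eq_mul, map_mul, φ.compat V W hV h s]
    congr 1
    rw [← ConcreteCategory.comp_apply, ← Functor.map_comp]; rfl⟩⟩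

@[simp] lemma zero_app (h : V ≤ U) : (0 : DualSection P U).app V h = 0 := rfl
@[simp] lemma add_app (φ ψ : DualSection P U) (h : V ≤ U) :
    (φ + ψ).app V h = φ.app V h + ψ.app V h := rfl
@[simp] lemma neg_app (φ : DualSection P U) (h : V ≤ U) : (-φ).app V h = -φ.app V h := rfl
@[simp] lemma smul_app (a : Γ(X, U)) (φ : DualSection P U) (h : V ≤ U) :
    (a • φ).app V h = X.presheaf.map (homOfLE h).op a • φ.app V h := rfl

instance : AddCommGroup (DualSection P U) where
  add_assoc φ ψ χ := by ext; simp [add_assoc]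
  zero_add φ := by ext; simp
  add_zero φ := by ext; simp
  add_comm φ ψ := by ext; simp [add_comm]
  neg_add_cancel φ := by ext; simp
  nsmul := nsmulRec
  zsmul := zsmulRec

instance : Module Γ(X, U) (DualSection P U) where
  one_smul φ := by ext; simp
  mul_smul a b φ := by ext; simp [mul_assoc]
  smul_zero a := by ext; simp
  smul_add a φ ψ := by ext; simp
  add_smul a b φ := by ext; simp [add_mul]
  zero_smul φ := by ext; simp

/-- Restriction of sections of the dual. -/
def res (h : V ≤ U) : DualSection P U →+ DualSection P V where
  toFun φ := ⟨fun W hW => φ.app W (hW.trans h), fun A B _ hB s => φ.compat A B _ hB s⟩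
  map_zero' := rfl
  map_add' _ _ := rfl

end DualSection

variable (P) in
/-- The dual as a presheaf of abelian groups. -/
def dualAb : X.Opensᵒᵖ ⥤ Ab.{u} where
  obj U := AddCommGrpCat.of (DualSection P U.unop)
  map f := AddCommGrpCat.ofHom (DualSection.res (leOfHom f.unop))

instance (U : X.Opensᵒᵖ) : Module (X.ringCatSheaf.obj.obj U) ((dualAb P).obj U) :=
  inferInstanceAs (Module Γ(X, U.unop) (DualSection P U.unop))

lemma DualSection.res_smul (h : V ≤ U) (a : Γ(X, U)) (φ : DualSection P U) :
    DualSection.res h (a • φ) = X.presheaf.map (homOfLE h).op a • DualSection.res h φ := by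
  refine DualSection.ext ?_
  funext W hW
  change X.presheaf.map (homOfLE _).op a • φ.app W _ =
    X.presheaf.map (homOfLE hW).op (X.presheaf.map (homOfLE h).op a) • φ.app W _
  rw [← ConcreteCategory.comp_apply, ← Functor.map_comp]
  rfl

variable (P) in
/-- The dual `P^∨ = ℋom(P, 𝒪_X)` as a presheaf of `𝒪_X`-modules. -/
def dual : X.PresheafOfModules :=
  PresheafOfModules.ofPresheaf (dualAb P)
    (fun _ _ f a φ => DualSection.res_smul (leOfHom f.unop) a φ)

/-- The natural map `P(U) → P^∨^∨(U)` into the double dual, `s ↦ (φ ↦ φ(s))`. -/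
def evalDual (U : X.Opens) (s : P.obj (op U)) : DualSection (dual P) U where
  app V hV :=
    { toFun := fun φ : DualSection P V => φ.app V le_rfl (P.restrictₛₗ (homOfLE hV).op s)
      map_add' := fun φ ψ => rfl
      map_smul' := fun (a : Γ(X, V)) (φ : DualSection P V) => by
        change (X.presheaf.map (𝟙 _) a) * _ = a * _
        rw [CategoryTheory.Functor.map_id]; rfl }
  compat := by
    intro V W hV h φ
    refine (DualSection.compat (show DualSection P V from φ) V W le_rfl h _).trans ?_
    refine congrArg (DualSection.app (show DualSection P V from φ) W h) ?_
    exact (P.map_comp_apply (homOfLE hV).op (homOfLE h).op s).symm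

/-- The stalk of a presheaf of modules is a module over the stalk of the presheaf of rings. -/
@[reducible] def stalkModule {Y : TopCat.{u}} (R : Y.Presheaf CommRingCat.{u})
    (M : PresheafOfModules.{u} (R ⋙ forget₂ CommRingCat RingCat)) (x : Y) :
    Module (R.stalk x) ↑(TopCat.Presheaf.stalk (C := Ab.{u}) M.presheaf x) := inferInstance

instance (M : X.Modules) (x : X) : Module (X.presheaf.stalk x)
    ↑(TopCat.Presheaf.stalk (C := Ab.{u}) M.presheaf x) :=
  stalkModule X.presheaf M.val x

/-- A sheaf of modules `F` is coherent if `X` is covered by affine opens `U` on each of which `F` is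
the sheaf associated with a finitely generated `Γ(X, U)`-module. -/
def IsCoherent (F : X.Modules) : Prop :=
  ∀ x : X, ∃ (U : X.Opens) (hU : IsAffineOpen U), x ∈ U ∧ ∃ N : ModuleCat.{u} Γ(X, U),
    Module.Finite Γ(X, U) N ∧ Nonempty (F.restrict hU.fromSpec ≅ tilde N)

/-- A reflexive sheaf: a coherent sheaf whose natural map into the double dual is an
isomorphism. -/
def IsReflexive (F : X.Modules) : Prop :=
  IsCoherent F ∧ ∀ U : X.Opens, Function.Bijective (evalDual (P := F.val) U)

/-- The rank of a sheaf of modules on an integral scheme: the dimension of its generic stalk over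
the function field. -/
def rank [IsIntegral X] (F : X.Modules) : ℕ :=
  Module.finrank (X.presheaf.stalk (genericPoint X))
    ↑(TopCat.Presheaf.stalk (C := Ab.{u}) F.presheaf (genericPoint X))

end Dual

section Decoration
variable (X : Scheme.{u})

/-- A prime divisor of `X`, given by its generic point: a point of codimension one. -/
def PrimeDivisor : Type u := {P : X // Order.coheight P = 1}

/-- The group of Weil divisors. -/
abbrev WeilDivisor : Type u := PrimeDivisor X →₀ ℤ

variable {X}

/-- The coefficient of a Weil divisor at a prime divisor; the formal divisor `∞` has all
coefficients `∞`. -/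
def coeff (D : WithTop (WeilDivisor X)) (P : PrimeDivisor X) : WithTop ℤ := D.map fun E => E P

lemma coeff_inf_le {D E F : WithTop (WeilDivisor X)} (h : D ⊓ E ≤ F) (P : PrimeDivisor X) :
    coeff D P ⊓ coeff E P ≤ coeff F P := by
  cases D with
  | top => cases F with
    | top => exact le_top
    | coe F => cases E with
      | top => simp at h
      | coe E =>
        have h' : E ≤ F := by simpa using h
        exact inf_le_right.trans (WithTop.coe_le_coe.2 (h' P))
  | coe D => cases F with
    | top => exact le_top
    | coe F => cases E with
      | top =>
        have h' : D ≤ F := by simpa using h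
        exact inf_le_left.trans (WithTop.coe_le_coe.2 (h' P))
      | coe E =>
        have h' : D ⊓ E ≤ F := by exact_mod_cast h
        have := h' P
        rw [Finsupp.inf_apply] at this
        change ((D P : ℤ) : WithTop ℤ) ⊓ ((E P : ℤ) : WithTop ℤ) ≤ ((F P : ℤ) : WithTop ℤ)
        exact_mod_cast this

variable [IsIntegral X]

/-- The rational function defined by a regular function on `U`; the point `x` only witnesses that
`U` is non-empty. -/
def germAt {U : X.Opens} (x : U) : Γ(X, U) →+* X.functionField :=
  haveI : Nonempty U := ⟨x⟩
  (X.germToFunctionField U).hom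

lemma germAt_eq {U : X.Opens} (x y : U) : (germAt x : Γ(X, U) →+* X.functionField) = germAt y := rfl

lemma germAt_map {U U' : X.Opens} (h : U' ≤ U) (x : U') (a : Γ(X, U)) :
    germAt x (X.presheaf.map (homOfLE h).op a) = germAt ⟨x.1, h x.2⟩ a :=
  TopCat.Presheaf.germ_res_apply X.presheaf (homOfLE h) _ _ a

open Classical in
/-- The value `f(P)` of a rational function at the generic point of a prime divisor: its residue class
in the residue field of `P` if `f` is regular there, and `∞` otherwise. -/
def value (P : PrimeDivisor X) (f : X.functionField) : WithTop (X.residueField P.1) :=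
  if h : ∃ a : X.presheaf.stalk P.1, algebraMap (X.presheaf.stalk P.1) X.functionField a = f then
    ((X.residue P.1 h.choose : X.residueField P.1) : WithTop (X.residueField P.1))
  else ⊤

variable [IsLocallyNoetherian X]

open Classical in
/-- The order of vanishing `ord_P f`, with `ord_P 0 = ∞`. -/
def ordTop (P : PrimeDivisor X) (f : X.functionField) : WithTop ℤ :=
  if f = 0 then ⊤ else (Scheme.ord f P.1 : ℤ)

lemma ordTop_germ_nonneg (P : PrimeDivisor X) {U : X.Opens} [Nonempty U] (hP : P.1 ∈ U)
    (a : Γ(X, U)) : 0 ≤ ordTop P (X.germToFunctionField U a) := by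
  unfold ordTop
  split_ifs with h
  · exact le_top
  · have ha : a ≠ 0 := by rintro rfl; simp at h
    have h1 := Scheme.ord_le_smul hP ha (1 : X.functionField)
    have h2 : Scheme.ord (1 : X.functionField) P.1 = 0 := by
      have := Scheme.ord_of_isUnit (U := U) (f := 1) isUnit_one hP
      simpa using this
    rw [h2, Algebra.smul_def, mul_one] at h1
    exact_mod_cast h1

variable (X) in
/-- A pre-Weil decoration `W : V → Div(X) ∪ {∞}` of a vector space `V` over the function field:
`W(v) = ∞` if and only if `v = 0`, `W(f v) = div(f) + W(v)` (read off on the coefficients), and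
`W(v) ∧ W(v') ≤ W(v + v')`, where `∧` is the coefficientwise minimum. -/
structure PreWeilDecoration (V : Type u) [AddCommGroup V] [Module X.functionField V] where
  toFun : V → WithTop (WeilDivisor X)
  eq_top_iff : ∀ v, toFun v = ⊤ ↔ v = 0
  smul : ∀ (f : X.functionField) (v : V) (P : PrimeDivisor X),
    coeff (toFun (f • v)) P = ordTop P f + coeff (toFun v) P
  inf_le_add : ∀ v v' : V, toFun v ⊓ toFun v' ≤ toFun (v + v')

namespace PreWeilDecoration
variable {V : Type u} [AddCommGroup V] [Module X.functionField V] (W : PreWeilDecoration X V)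

lemma coeff_zero (P : PrimeDivisor X) : coeff (W.toFun 0) P = ⊤ := by
  rw [(W.eq_top_iff 0).2 rfl]; rfl

/-- The sections over `U` of the sheaf associated with `W`: the `v ∈ V` with `W(v)|_U ≥ 0`, seen as
constant functions on `U` (so that `0` is the only section over the empty set). -/
def sections (U : X.Opens) : AddSubgroup (U → V) where
  carrier := {s | (∀ x y, s x = s y) ∧
    ∀ x, ∀ P : PrimeDivisor X, P.1 ∈ U → 0 ≤ coeff (W.toFun (s x)) P}
  zero_mem' := ⟨fun _ _ => rfl, fun x P _ => by
    rw [Pi.zero_apply, coeff_zero]; exact le_top⟩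
  add_mem' {s t} hs ht := ⟨fun x y => by rw [Pi.add_apply, hs.1 x y, ht.1 x y, Pi.add_apply],
    fun x P hP => (le_inf (hs.2 x P hP) (ht.2 x P hP)).trans
      (coeff_inf_le (W.inf_le_add (s x) (t x)) P)⟩
  neg_mem' {s} hs := ⟨fun x y => by rw [Pi.neg_apply, hs.1 x y, Pi.neg_apply],
    fun x P hP => by
      have : Nonempty U := ⟨x⟩
      have h1 := ordTop_germ_nonneg P hP (-1 : Γ(X, U))
      rw [map_neg, map_one] at h1
      have h2 := W.smul (-1) (s x) P
      rw [neg_smul, one_smul] at h2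
      rw [Pi.neg_apply, h2]
      exact add_nonneg h1 (hs.2 x P hP)⟩

instance (U : X.Opens) : SMul Γ(X, U) (W.sections U) :=
  ⟨fun a s => ⟨fun x => germAt x a • s.1 x,
    fun x y => by
      change germAt x a • s.1 x = germAt x a • s.1 y
      rw [s.2.1 x y],
    fun x P hP => by
      have : Nonempty U := ⟨x⟩
      rw [W.smul]
      exact add_nonneg (ordTop_germ_nonneg P hP a) (s.2.2 x P hP)⟩⟩

instance (U : X.Opens) : Module Γ(X, U) (W.sections U) where
  one_smul s := by ext x; change germAt x 1 • s.1 x = _; simp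
  mul_smul a b s := by
    ext x; change germAt x (a * b) • s.1 x = germAt x a • germAt x b • s.1 x; rw [map_mul, mul_smul]
  smul_zero a := by ext x; exact smul_zero _
  smul_add a s t := by ext x; exact smul_add _ _ _
  add_smul a b s := by
    ext x; change germAt x (a + b) • s.1 x = germAt x a • s.1 x + germAt x b • s.1 x
    rw [map_add, add_smul]
  zero_smul s := by ext x; change germAt x 0 • s.1 x = 0; rw [map_zero, zero_smul]

/-- Restriction of sections. -/
def res {U U' : X.Opens} (h : U' ≤ U) : W.sections U →+ W.sections U' where
  toFun s := ⟨fun x => s.1 ⟨x.1, h x.2⟩, fun _ _ => s.2.1 _ _, fun _ P hP => s.2.2 _ P (h hP)⟩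
  map_zero' := rfl
  map_add' _ _ := rfl

/-- The associated sheaf as a presheaf of abelian groups. -/
def sheafAb : TopCat.Presheaf Ab.{u} X where
  obj U := AddCommGrpCat.of (W.sections U.unop)
  map f := AddCommGrpCat.ofHom (W.res (leOfHom f.unop))

instance (U : X.Opensᵒᵖ) : Module (X.ringCatSheaf.obj.obj U) (W.sheafAb.obj U) :=
  inferInstanceAs (Module Γ(X, U.unop) (W.sections U.unop))

lemma isSheaf_sheafAb : W.sheafAb.IsSheaf := by
  refine (TopCat.Presheaf.isSheaf_iff_isSheafUniqueGluing _).2 fun ι U sf hsf => ?_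
  replace hsf : ∀ i j (x : X) (hi : x ∈ U i) (hj : x ∈ U j),
      (show W.sections (U i) from sf i).1 ⟨x, hi⟩ = (show W.sections (U j) from sf j).1 ⟨x, hj⟩ :=
    fun i j x hi hj => congrFun (congrArg Subtype.val (hsf i j)) ⟨x, hi, hj⟩
  have hex : ∀ x : ↑(iSup U), ∃ i, x.1 ∈ U i := fun x => Opens.mem_iSup.1 x.2
  have key : ∀ i j (x y : X) (hx : x ∈ U i) (hy : y ∈ U j),
      (show W.sections (U i) from sf i).1 ⟨x, hx⟩ =
        (show W.sections (U j) from sf j).1 ⟨y, hy⟩ := by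
    intro i j x y hx hy
    obtain ⟨z, hzi, hzj⟩ := nonempty_preirreducible_inter (U i).isOpen (U j).isOpen
      ⟨x, hx⟩ ⟨y, hy⟩
    rw [(show W.sections (U i) from sf i).2.1 ⟨x, hx⟩ ⟨z, hzi⟩, hsf i j z hzi hzj,
      (show W.sections (U j) from sf j).2.1 ⟨z, hzj⟩ ⟨y, hy⟩]
  choose c hc using hex
  refine ⟨(⟨fun x => (show W.sections (U (c x)) from sf (c x)).1 ⟨x.1, hc x⟩,
    fun x y => key _ _ _ _ _ _, fun x P hP => ?_⟩ : W.sections (iSup U)),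
    fun i => Subtype.ext (funext fun x => key _ _ _ _ _ _), fun t ht => ?_⟩
  · obtain ⟨j, hj⟩ := Opens.mem_iSup.1 hP
    exact ((show W.sections (U j) from sf j).2.2 ⟨P.1, hj⟩ P hj).trans_eq
      (congrArg (fun v => coeff (W.toFun v) P) (key j (c x) P.1 x.1 hj (hc x)))
  · refine Subtype.ext (funext fun x => ?_)
    exact congrFun (congrArg Subtype.val (ht (c x))) ⟨x.1, hc x⟩

/-- The sheaf of `𝒪_X`-modules `𝒪_X(W)` associated with `W`. -/
def sheaf : X.Modules where
  val := PresheafOfModules.ofPresheaf W.sheafAb fun U U' f a s => by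
    refine Subtype.ext (funext fun x => ?_)
    exact congrArg (· • _) (germAt_map (leOfHom f.unop) x a).symm
  isSheaf := W.isSheaf_sheafAb

/-- A Weil decoration is a pre-Weil decoration which is coherent: its associated sheaf is
coherent. -/
def IsWeilDecoration : Prop := IsCoherent W.sheaf

end PreWeilDecoration

end Decoration

section Fan
variable {M : Type u} [AddCommGroup M]

/-- The image of a lattice vector `n ∈ N = Hom(M, ℤ)` in `N_ℝ = Hom(M, ℝ)`. -/
def toReal (n : M →ₗ[ℤ] ℤ) : M →ₗ[ℤ] ℝ := Algebra.linearMap ℤ ℝ ∘ₗ n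

@[simp] lemma toReal_apply (n : M →ₗ[ℤ] ℤ) (m : M) : toReal n m = (n m : ℝ) := rfl

/-- The monoid `σ^∨ ∩ M` of the lattice points `m` with `⟨m, v⟩ ≥ 0` for all `v ∈ σ`. -/
def dualMonoid (σ : PointedCone ℝ (M →ₗ[ℤ] ℝ)) : AddSubmonoid M where
  carrier := {m | ∀ v ∈ σ, 0 ≤ v m}
  zero_mem' := by simp
  add_mem' ha hb v hv := by simpa using add_nonneg (ha v hv) (hb v hv)

lemma mem_dualMonoid {σ : PointedCone ℝ (M →ₗ[ℤ] ℝ)} {m : M} :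
    m ∈ dualMonoid σ ↔ ∀ v ∈ σ, 0 ≤ v m := Iff.rfl

lemma dualMonoid_anti {σ τ : PointedCone ℝ (M →ₗ[ℤ] ℝ)} (h : τ ≤ σ) :
    dualMonoid σ ≤ dualMonoid τ := fun _ hm v hv => hm v (h hv)

/-- `τ` is a face of the rational cone `σ`: `τ = σ ∩ m^⊥` for some `m ∈ σ^∨ ∩ M`. -/
def IsFace (τ σ : PointedCone ℝ (M →ₗ[ℤ] ℝ)) : Prop :=
  ∃ m ∈ dualMonoid σ, ∀ v, v ∈ τ ↔ v ∈ σ ∧ v m = 0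

/-- `σ` is generated by finitely many vectors of the lattice `N = Hom(M, ℤ)`. -/
def IsRationalPolyhedral (σ : PointedCone ℝ (M →ₗ[ℤ] ℝ)) : Prop :=
  ∃ S : Finset (M →ₗ[ℤ] ℤ), σ = PointedCone.hull ℝ (toReal '' (S : Set (M →ₗ[ℤ] ℤ)))

variable (M) in
/-- A fan in `N_ℝ = Hom(M, ℝ)`: a finite non-empty set of strongly convex rational polyhedral cones,
closed under taking faces, such that the intersection of any two of them is a face of each. -/
structure Fan where
  cones : Set (PointedCone ℝ (M →ₗ[ℤ] ℝ))
  finite : cones.Finite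
  zero_mem : ⊥ ∈ cones
  rational : ∀ σ ∈ cones, IsRationalPolyhedral σ
  stronglyConvex : ∀ σ ∈ cones, ∀ v ∈ σ, -v ∈ σ → v = 0
  face_mem : ∀ σ ∈ cones, ∀ τ, IsFace τ σ → τ ∈ cones
  isFace_inf : ∀ σ ∈ cones, ∀ τ ∈ cones, IsFace (σ ⊓ τ) σ

lemma mem_dualMonoid_hull {S : Finset (M →ₗ[ℤ] ℤ)} {m : M} :
    m ∈ dualMonoid (PointedCone.hull ℝ (toReal '' (S : Set (M →ₗ[ℤ] ℤ)))) ↔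
      ∀ n ∈ S, 0 ≤ n m := by
  constructor
  · intro h n hn
    have := h (toReal n) (Submodule.subset_span ⟨n, hn, rfl⟩)
    simpa using this
  · intro h v hv
    induction hv using Submodule.span_induction with
    | mem v hv => obtain ⟨n, hn, rfl⟩ := hv; simpa using h n hn
    | zero => simp
    | add v w _ _ hv hw => simpa using add_nonneg hv hw
    | smul a v _ hv =>
      change 0 ≤ (a : ℝ) * v m
      exact mul_nonneg a.2 hv

lemma dualMonoid_fg [Module.Free ℤ M] [Module.Finite ℤ M] {σ : PointedCone ℝ (M →ₗ[ℤ] ℝ)}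
    (hσ : IsRationalPolyhedral σ) : (dualMonoid σ).FG := by
  classical
  obtain ⟨S, rfl⟩ := hσ
  let b := Module.finBasis ℤ M
  let ι := Fin (Module.finrank ℤ M)
  let pos : (ι ⊕ ι ⊕ S → ℕ) →+ M :=
    { toFun := fun a => ∑ i, (a (.inl i)) • b i
      map_zero' := by simp
      map_add' := by intro x y; simp [add_smul, Finset.sum_add_distrib] }
  let neg : (ι ⊕ ι ⊕ S → ℕ) →+ M :=
    { toFun := fun a => ∑ i, (a (.inr (.inl i))) • b i
      map_zero' := by simp
      map_add' := by intro x y; simp [add_smul, Finset.sum_add_distrib] }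
  let f : (ι ⊕ ι ⊕ S → ℕ) →+ (S → ℤ) :=
    { toFun := fun a n => n.1 (pos a)
      map_zero' := by ext; simp
      map_add' := by intro x y; ext; simp }
  let g : (ι ⊕ ι ⊕ S → ℕ) →+ (S → ℤ) :=
    { toFun := fun a n => n.1 (neg a) + (a (.inr (.inr n)) : ℤ)
      map_zero' := by ext; simp
      map_add' := by intro x y; ext; simp; ring }
  have hfg := (AddSubmonoid.fg_eqLocusM f g).map (pos - neg)
  convert! hfg
  ext m
  rw [mem_dualMonoid_hull, AddSubmonoid.mem_map]
  constructor
  · intro h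
    refine ⟨Sum.elim (fun i => (b.repr m i).toNat) (Sum.elim (fun i => (-b.repr m i).toNat)
      (fun n => (n.1 m).toNat)), ?_, ?_⟩
    all_goals
      have key : pos (Sum.elim (fun i => (b.repr m i).toNat) (Sum.elim
        (fun i => (-b.repr m i).toNat) (fun n => (n.1 m).toNat))) - neg (Sum.elim
        (fun i => (b.repr m i).toNat) (Sum.elim (fun i => (-b.repr m i).toNat)
        (fun n => (n.1 m).toNat))) = m := by
        change ∑ i, ((b.repr m i).toNat) • b i - ∑ i, ((-b.repr m i).toNat) • b i = m
        rw [← Finset.sum_sub_distrib]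
        conv_rhs => rw [← b.sum_repr m]
        refine Finset.sum_congr rfl fun i _ => ?_
        rw [← natCast_zsmul, ← natCast_zsmul, ← sub_smul, Int.toNat_sub_toNat_neg]
    · change f _ = g _
      funext n
      rw [sub_eq_iff_eq_add] at key
      change n.1 (pos _) = n.1 (neg _) + (((n.1 m).toNat : ℕ) : ℤ)
      rw [key, map_add, Int.toNat_of_nonneg (h n.1 n.2), add_comm]
    · exact key
  · rintro ⟨a, ha, rfl⟩ n hn
    have := congrFun (show f a = g a from ha) ⟨n, hn⟩
    change n (pos a) = n (neg a) + (a (.inr (.inr ⟨n, hn⟩)) : ℤ) at this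
    change 0 ≤ n (pos a - neg a)
    rw [map_sub, this]
    simp

section Charts
variable (k : Type u) [Field k]

/-- The coordinate ring `k[σ^∨ ∩ M]`. -/
abbrev CoordRing (σ : PointedCone ℝ (M →ₗ[ℤ] ℝ)) : Type u := AddMonoidAlgebra k (dualMonoid σ)

/-- The monomial `x^m` for `m ∈ σ^∨ ∩ M`. -/
abbrev chi (σ : PointedCone ℝ (M →ₗ[ℤ] ℝ)) (m : dualMonoid σ) : CoordRing k σ :=
  AddMonoidAlgebra.single m 1

variable {k} in
lemma chi_mul {σ : PointedCone ℝ (M →ₗ[ℤ] ℝ)} (m m' : dualMonoid σ) :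
    chi k σ m * chi k σ m' = chi k σ (m + m') := by simp [chi]

/-- The inclusion `k[σ^∨ ∩ M] → k[τ^∨ ∩ M]` for `τ ⊆ σ`. -/
def coordMap {σ τ : PointedCone ℝ (M →ₗ[ℤ] ℝ)} (h : τ ≤ σ) : CoordRing k σ →+* CoordRing k τ :=
  AddMonoidAlgebra.mapDomainRingHom k (AddSubmonoid.inclusion (dualMonoid_anti h))

lemma coordMap_single {σ τ : PointedCone ℝ (M →ₗ[ℤ] ℝ)} (h : τ ≤ σ) (m : dualMonoid σ) (a : k) :
    coordMap k h (AddMonoidAlgebra.single m a) =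
      AddMonoidAlgebra.single (⟨m.1, dualMonoid_anti h m.2⟩ : dualMonoid τ) a := by
  simp [coordMap]; rfl

lemma coordMap_injective {σ τ : PointedCone ℝ (M →ₗ[ℤ] ℝ)} (h : τ ≤ σ) :
    Function.Injective (coordMap k h) :=
  AddMonoidAlgebra.mapDomain_injective
    (fun _ _ hxy => Subtype.ext (congrArg (fun z : dualMonoid τ => (z : M)) hxy))

lemma coordMap_refl (σ : PointedCone ℝ (M →ₗ[ℤ] ℝ)) : coordMap k (le_refl σ) = RingHom.id _ := by
  refine AddMonoidAlgebra.ringHom_ext (fun a => ?_) (fun m => ?_) <;>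
  · rw [coordMap_single]; rfl

lemma coordMap_comp {σ τ υ : PointedCone ℝ (M →ₗ[ℤ] ℝ)} (h : τ ≤ σ) (h' : υ ≤ τ) :
    (coordMap k h').comp (coordMap k h) = coordMap k (h'.trans h) := by
  refine AddMonoidAlgebra.ringHom_ext (fun a => ?_) (fun m => ?_) <;>
  · simp only [RingHom.comp_apply, coordMap_single]

lemma exists_nsmul_add_mem {σ τ : PointedCone ℝ (M →ₗ[ℤ] ℝ)} (hσ : IsRationalPolyhedral σ)
    {m : M} (hm : m ∈ dualMonoid σ) (hτ : ∀ v, v ∈ τ ↔ v ∈ σ ∧ v m = 0)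
    {m' : M} (hm' : m' ∈ dualMonoid τ) : ∃ l₀ : ℕ, ∀ l ≥ l₀, m' + l • m ∈ dualMonoid σ := by
  classical
  obtain ⟨S, rfl⟩ := hσ
  have hmS := mem_dualMonoid_hull.1 hm
  refine ⟨∑ n ∈ S, (n m').natAbs, fun l hl => mem_dualMonoid_hull.2 fun n hn => ?_⟩
  have h1 : (n m').natAbs ≤ l :=
    (Finset.single_le_sum (f := fun n : M →ₗ[ℤ] ℤ => (n m').natAbs) (fun _ _ => Nat.zero_le _)
      hn).trans hl
  rw [map_add, map_nsmul, nsmul_eq_mul]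
  rcases (hmS n hn).eq_or_lt with h0 | h0
  · have hv : toReal n ∈ τ := (hτ _).2 ⟨Submodule.subset_span ⟨n, hn, rfl⟩, by simp [← h0]⟩
    have := hm' _ hv
    simp only [toReal_apply, Int.cast_nonneg_iff] at this
    simp [← h0, this]
  · have : (l : ℤ) * 1 ≤ l * n m := by gcongr; omega
    omega

lemma isLocalization_coordMap {σ τ : PointedCone ℝ (M →ₗ[ℤ] ℝ)} (hσ : IsRationalPolyhedral σ)
    (m : dualMonoid σ) (hτ : ∀ v, v ∈ τ ↔ v ∈ σ ∧ v (m : M) = 0) (h : τ ≤ σ) :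
    letI := (coordMap k h).toAlgebra
    IsLocalization.Away (chi k σ m) (CoordRing k τ) := by
  let := (coordMap k h).toAlgebra
  have hneg : -(m : M) ∈ dualMonoid τ := fun v hv => by simp [((hτ v).1 hv).2]
  have hpow : ∀ l : ℕ, chi k σ m ^ l = chi k σ (l • m) := fun l => by
    simp [chi, AddMonoidAlgebra.single_pow]
  refine (isLocalization_iff _ _).2 ⟨?_, ?_, ?_⟩
  · rintro ⟨_, l, rfl⟩
    change IsUnit (coordMap k h (chi k σ m ^ l))
    rw [map_pow]
    refine IsUnit.pow _ (IsUnit.of_mul_eq_one (chi k τ ⟨_, hneg⟩) ?_)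
    rw [coordMap_single, chi_mul, AddMonoidAlgebra.one_def]
    congr 1
    exact Subtype.ext (add_neg_cancel _)
  · have key : ∀ z : CoordRing k τ, ∃ l₀ : ℕ, ∀ l ≥ l₀, ∃ x, z * coordMap k h (chi k σ (l • m)) =
        coordMap k h x := by
      intro z
      induction z using AddMonoidAlgebra.induction_linear with
      | zero => exact ⟨0, fun l _ => ⟨0, by simp⟩⟩
      | add f g hf hg =>
        obtain ⟨a, ha⟩ := hf
        obtain ⟨b, hb⟩ := hg
        refine ⟨max a b, fun l hl => ?_⟩
        obtain ⟨x, hx⟩ := ha l (le_of_max_le_left hl)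
        obtain ⟨y, hy⟩ := hb l (le_of_max_le_right hl)
        exact ⟨x + y, by rw [add_mul, hx, hy, map_add]⟩
      | single m' a =>
        obtain ⟨l₀, hl₀⟩ := exists_nsmul_add_mem hσ m.2 hτ m'.2
        refine ⟨l₀, fun l hl => ⟨AddMonoidAlgebra.single ⟨_, hl₀ l hl⟩ a, ?_⟩⟩
        rw [coordMap_single, coordMap_single, AddMonoidAlgebra.single_mul_single, mul_one]
        congr 1
    intro z
    obtain ⟨l, hl⟩ := key z
    obtain ⟨x, hx⟩ := hl l le_rfl
    exact ⟨(x, ⟨_, l, rfl⟩), by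
      change z * coordMap k h (chi k σ m ^ l) = _
      rw [hpow]; exact hx⟩
  · intro x y hxy
    exact ⟨1, by rw [coordMap_injective k h hxy]⟩

/-- The affine toric variety `U_σ = Spec k[σ^∨ ∩ M]`. -/
abbrev affineChart (σ : PointedCone ℝ (M →ₗ[ℤ] ℝ)) : Scheme.{u} := Spec (.of (CoordRing k σ))

/-- The map `U_τ → U_σ` for `τ ⊆ σ`; an open immersion if `τ` is a face of `σ`. -/
def chartMap {σ τ : PointedCone ℝ (M →ₗ[ℤ] ℝ)} (h : τ ≤ σ) : affineChart k τ ⟶ affineChart k σ :=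
  Spec.map (CommRingCat.ofHom (coordMap k h))

lemma isOpenImmersion_chartMap {σ τ : PointedCone ℝ (M →ₗ[ℤ] ℝ)} (hσ : IsRationalPolyhedral σ)
    (m : dualMonoid σ) (hτ : ∀ v, v ∈ τ ↔ v ∈ σ ∧ v (m : M) = 0) (h : τ ≤ σ) :
    IsOpenImmersion (chartMap k h) := by
  let := (coordMap k h).toAlgebra
  have := isLocalization_coordMap k hσ m hτ h
  exact IsOpenImmersion.of_isLocalization (chi k σ m)

lemma range_chartMap {σ τ : PointedCone ℝ (M →ₗ[ℤ] ℝ)} (hσ : IsRationalPolyhedral σ)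
    (m : dualMonoid σ) (hτ : ∀ v, v ∈ τ ↔ v ∈ σ ∧ v (m : M) = 0) (h : τ ≤ σ) :
    Set.range (chartMap k h) = (PrimeSpectrum.basicOpen (chi k σ m) : Set (PrimeSpectrum _)) := by
  let := (coordMap k h).toAlgebra
  have := isLocalization_coordMap k hσ m hτ h
  exact PrimeSpectrum.localization_away_comap_range (CoordRing k τ) (chi k σ m)

lemma chartMap_comp {σ τ υ : PointedCone ℝ (M →ₗ[ℤ] ℝ)} (h : τ ≤ σ) (h' : υ ≤ τ) :
    chartMap k h' ≫ chartMap k h = chartMap k (h'.trans h) := by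
  change Spec.map _ ≫ Spec.map _ = Spec.map _
  rw [← Spec.map_comp, ← CommRingCat.ofHom_comp, coordMap_comp]

lemma chartMap_chartMap {σ τ υ : PointedCone ℝ (M →ₗ[ℤ] ℝ)} (h : τ ≤ σ) (h' : υ ≤ τ)
    (z : affineChart k υ) : chartMap k h (chartMap k h' z) = chartMap k (h'.trans h) z := by
  rw [← chartMap_comp k h h', Scheme.Hom.comp_apply]

/-- The gluing diagram of the affine toric varieties `U_σ`, `σ ∈ Δ`. -/
def chartFunctor (Δ : Fan M) : Δ.cones ⥤ Scheme.{u} where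
  obj σ := affineChart k σ.1
  map f := chartMap k (leOfHom f)
  map_id σ := by
    change Spec.map (CommRingCat.ofHom (coordMap k (le_refl σ.1))) = _
    rw [coordMap_refl]
    exact Spec.map_id _
  map_comp f g := (chartMap_comp k (leOfHom g) (leOfHom f)).symm

variable (Δ : Fan M)

instance {σ τ : Δ.cones} (f : τ ⟶ σ) : IsOpenImmersion ((chartFunctor k Δ).map f) := by
  obtain ⟨m, hm, h⟩ := Δ.isFace_inf σ.1 σ.2 τ.1 τ.2
  rw [inf_eq_right.2 (leOfHom f)] at h
  exact isOpenImmersion_chartMap k (Δ.rational _ σ.2) ⟨m, hm⟩ h (leOfHom f)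

lemma Fan.inf_mem (σ τ : Δ.cones) : σ.1 ⊓ τ.1 ∈ Δ.cones :=
  Δ.face_mem _ σ.2 _ (Δ.isFace_inf _ σ.2 _ τ.2)

instance : (chartFunctor k Δ ⋙ Scheme.forget).IsLocallyDirected where
  cond {σ τ υ} f g x y hxy := by
    let l : Δ.cones := ⟨σ.1 ⊓ τ.1, Δ.inf_mem σ τ⟩
    let f' : l ⟶ σ := homOfLE (show σ.1 ⊓ τ.1 ≤ σ.1 from inf_le_left)
    let g' : l ⟶ τ := homOfLE (show σ.1 ⊓ τ.1 ≤ τ.1 from inf_le_right)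
    obtain ⟨m, hm, h⟩ := Δ.isFace_inf υ.1 υ.2 τ.1 τ.2
    rw [inf_eq_right.2 (leOfHom g)] at h
    have hmσ : m ∈ dualMonoid σ.1 := dualMonoid_anti (leOfHom f) hm
    have hxy' : chartMap k (leOfHom f) x = chartMap k (leOfHom g) y := hxy
    have h1 : chartMap k (leOfHom g) y ∈ Set.range (chartMap k (leOfHom g)) := ⟨y, rfl⟩
    rw [range_chartMap k (Δ.rational _ υ.2) ⟨m, hm⟩ h, ← hxy'] at h1
    have h2 : x ∈ Set.range (chartMap k (leOfHom f')) := by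
      rw [range_chartMap k (Δ.rational _ σ.2) ⟨m, hmσ⟩
        (fun v : M →ₗ[ℤ] ℝ => show v ∈ σ.1 ⊓ τ.1 ↔ v ∈ σ.1 ∧ v m = 0 from ⟨fun hv => ⟨hv.1, ((h v).1 hv.2).2⟩,
          fun hv => ⟨hv.1, (h v).2 ⟨leOfHom f hv.1, hv.2⟩⟩⟩)]
      intro h3
      refine h1 ?_
      change coordMap k (leOfHom f) (chi k υ.1 ⟨m, hm⟩) ∈
        (show PrimeSpectrum (CoordRing k σ.1) from x).asIdeal
      rw [coordMap_single]
      exact h3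
    obtain ⟨z, hz⟩ := h2
    refine ⟨l, f', g', z, hz, ?_⟩
    refine ((chartFunctor k Δ).map g).isOpenEmbedding.injective ?_
    change chartMap k (leOfHom g) (chartMap k (leOfHom g') z) = chartMap k (leOfHom g) y
    rw [chartMap_chartMap, ← hxy', ← hz, chartMap_chartMap]

/-- The toric variety `X = X_Δ` of the fan `Δ`: the `U_σ` glued along the `U_τ`, `τ` a common
face. -/
def toricVariety : Scheme.{u} := Limits.colimit (chartFunctor k Δ)

/-- The open immersion `U_σ → X`. -/
def chart (σ : Δ.cones) : affineChart k σ.1 ⟶ toricVariety k Δ :=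
  Limits.colimit.ι (chartFunctor k Δ) σ

instance (σ : Δ.cones) : IsOpenImmersion (chart k Δ σ) :=
  inferInstanceAs (IsOpenImmersion (Limits.colimit.ι (chartFunctor k Δ) σ))

lemma exists_chart (x : toricVariety k Δ) : ∃ σ y, chart k Δ σ y = x :=
  Scheme.IsLocallyDirected.ι_jointly_surjective (chartFunctor k Δ) x

lemma chartMap_chart {σ τ : Δ.cones} (h : τ.1 ≤ σ.1) :
    chartMap k h ≫ chart k Δ σ = chart k Δ τ :=
  Limits.colimit.w (chartFunctor k Δ) (homOfLE h : τ ⟶ σ)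

/-- The zero cone; its chart is the torus `Spec k[M]`. -/
def Fan.zeroCone : Δ.cones := ⟨⊥, Δ.zero_mem⟩

/-- A primitive vector of the lattice `N`. -/
def IsPrimitive (n : M →ₗ[ℤ] ℤ) : Prop :=
  ∀ (d : ℤ) (n' : M →ₗ[ℤ] ℤ), n = d • n' → IsUnit d

/-- The half-line generated by `n`. -/
def rayCone (n : M →ₗ[ℤ] ℤ) : PointedCone ℝ (M →ₗ[ℤ] ℝ) := PointedCone.hull ℝ {toReal n}

lemma mem_dualMonoid_rayCone {n : M →ₗ[ℤ] ℤ} {m : M} : m ∈ dualMonoid (rayCone n) ↔ 0 ≤ n m := by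
  have := mem_dualMonoid_hull (S := {n}) (m := m)
  simpa [rayCone] using this

lemma IsPrimitive.exists_apply_eq_one {n : M →ₗ[ℤ] ℤ} (hn : IsPrimitive n) : ∃ m, n m = 1 := by
  obtain ⟨d, hd⟩ := (IsPrincipalIdealRing.principal (LinearMap.range n)).principal
  have hdvd : ∀ m, d ∣ n m := fun m =>
    Ideal.mem_span_singleton.1 (by rw [Ideal.span, ← hd]; exact ⟨m, rfl⟩)
  have hu : IsUnit d := by
    rcases eq_or_ne d 0 with rfl | h0
    · have : n = (0 : ℤ) • n := by ext m; simpa using hdvd m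
      exact hn 0 n this
    · refine hn d
        { toFun := fun m => n m / d
          map_add' := fun a b => by rw [map_add, Int.add_ediv_of_dvd_left (hdvd a)]
          map_smul' := fun c a => by simp [Int.mul_ediv_assoc _ (hdvd a)] } ?_
      ext m
      exact (Int.mul_ediv_cancel' (hdvd m)).symm
  have : (1 : ℤ) ∈ LinearMap.range n := by
    rw [hd]
    exact Ideal.mem_span_singleton.2 hu.dvd
  exact this

/-- The rays of the fan, each given by its primitive generator. -/
def Fan.Ray : Type u := {n : M →ₗ[ℤ] ℤ // IsPrimitive n ∧ rayCone n ∈ Δ.cones}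

variable {Δ} in
/-- The one-dimensional cone of a ray. -/
def Fan.Ray.cone (ρ : Δ.Ray) : Δ.cones := ⟨rayCone ρ.1, ρ.2.2⟩

/-- The ideal, in `k[ρ^∨ ∩ M]`, of the closed torus orbit of `U_ρ` (`ρ` the half-line through `n`):
it is generated by the monomials `x^m` with `⟨m, n⟩ > 0`. -/
def orbitIdeal (n : M →ₗ[ℤ] ℤ) : Ideal (CoordRing k (rayCone n)) :=
  Ideal.span {f | ∃ m : dualMonoid (rayCone n), 0 < n m ∧ f = chi k (rayCone n) m}

/-- The projection of `k[ρ^∨ ∩ M]` onto the span of the monomials `x^m` with `⟨m, n⟩ = 0`. -/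
def orbitRetract (n : M →ₗ[ℤ] ℤ) : CoordRing k (rayCone n) →ₐ[k] CoordRing k (rayCone n) :=
  open Classical in
  AddMonoidAlgebra.lift k _ (dualMonoid (rayCone n))
    { toFun := fun m => if n m.toAdd.1 = 0 then chi k (rayCone n) m.toAdd else 0
      map_one' := by simp [chi, AddMonoidAlgebra.one_def]
      map_mul' := fun a b => by
        have ha := mem_dualMonoid_rayCone.1 a.toAdd.2
        have hb := mem_dualMonoid_rayCone.1 b.toAdd.2
        have : n (a * b).toAdd.1 = n a.toAdd.1 + n b.toAdd.1 := map_add n _ _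
        rw [this]
        by_cases h1 : n a.toAdd.1 = 0 <;> by_cases h2 : n b.toAdd.1 = 0
        · simp [h1, h2]
        · simp [h1, h2]
        · simp [h1, h2]
        · rw [if_neg (by omega), if_neg h1, zero_mul] }

lemma orbitIdeal_eq_ker (n : M →ₗ[ℤ] ℤ) : orbitIdeal k n = RingHom.ker (orbitRetract k n) := by
  refine le_antisymm (Ideal.span_le.2 ?_) fun f hf => ?_
  · rintro _ ⟨m, hm, rfl⟩
    simp [RingHom.mem_ker, orbitRetract, hm.ne']
  · have key : ∀ g, g - orbitRetract k n g ∈ orbitIdeal k n := by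
      intro g
      induction g using AddMonoidAlgebra.induction_linear with
      | zero => simp
      | add a b ha hb => rw [map_add, add_sub_add_comm]; exact add_mem ha hb
      | single m a =>
        rcases (mem_dualMonoid_rayCone.1 m.2).eq_or_lt with h | h
        · simp [orbitRetract, ← h]
        · have : AddMonoidAlgebra.single m a = algebraMap k (CoordRing k (rayCone n)) a *
              chi k (rayCone n) m := by simp [chi]
          have h0 : orbitRetract k n (chi k (rayCone n) m) = 0 := by
            simp [orbitRetract, h.ne']
          rw [this, map_mul, AlgHom.commutes, ← mul_sub, h0, sub_zero]
          exact Ideal.mul_mem_left _ _ (Ideal.subset_span ⟨m, h, rfl⟩)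
    have := key f
    rwa [RingHom.mem_ker.1 hf, sub_zero] at this

lemma orbitIdeal_eq_span {n : M →ₗ[ℤ] ℤ} (m₀ : dualMonoid (rayCone n)) (h : n m₀ = 1) :
    orbitIdeal k n = Ideal.span {chi k (rayCone n) m₀} := by
  refine le_antisymm (Ideal.span_le.2 ?_) ((Ideal.span_singleton_le_iff_mem _).2
    (Ideal.subset_span ⟨m₀, by omega, rfl⟩))
  rintro _ ⟨m, hm, rfl⟩
  have h' : (m : M) - m₀ ∈ dualMonoid (rayCone n) :=
    mem_dualMonoid_rayCone.2 (by rw [map_sub]; omega)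
  refine Ideal.mem_span_singleton.2 ⟨chi k _ ⟨_, h'⟩, ?_⟩
  rw [chi_mul]
  congr 1
  exact Subtype.ext (add_sub_cancel _ _).symm

section Lattice
variable [Module.Free ℤ M] [Module.Finite ℤ M]

instance : IsDomain (AddMonoidAlgebra k M) := by
  have : AddMonoid.FG M := by
    have := Module.Finite.iff_addGroup_fg.1 (inferInstance : Module.Finite ℤ M)
    exact AddGroup.fg_iff_addMonoid_fg.1 this
  have : IsAddTorsionFree M := Module.isTorsionFree_int_iff_isAddTorsionFree.mp inferInstance
  infer_instance

instance (σ : PointedCone ℝ (M →ₗ[ℤ] ℝ)) : IsDomain (CoordRing k σ) :=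
  Function.Injective.isDomain (AddMonoidAlgebra.mapDomainRingHom k (dualMonoid σ).subtype)
    (AddMonoidAlgebra.mapDomain_injective Subtype.val_injective)

lemma isNoetherianRing_coordRing {σ : PointedCone ℝ (M →ₗ[ℤ] ℝ)} (hσ : IsRationalPolyhedral σ) :
    IsNoetherianRing (CoordRing k σ) := by
  have : AddMonoid.FG (dualMonoid σ) := (AddMonoid.fg_iff_addSubmonoid_fg _).2 (dualMonoid_fg hσ)
  exact Algebra.FiniteType.isNoetherianRing k _

instance : IrreducibleSpace (toricVariety k Δ) where
  isPreirreducible_univ := by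
    have hT : IsPreirreducible (Set.range (chart k Δ Δ.zeroCone)) := by
      rw [← Set.image_univ]
      exact (PreirreducibleSpace.isPreirreducible_univ).image _
        (chart k Δ Δ.zeroCone).continuous.continuousOn
    have hd : closure (Set.range (chart k Δ Δ.zeroCone)) = Set.univ := by
      refine Set.eq_univ_of_forall fun x => ?_
      obtain ⟨σ, y, rfl⟩ := exists_chart k Δ x
      rw [mem_closure_iff]
      intro U hU hy
      have h0 : Δ.zeroCone.1 ≤ σ.1 := bot_le
      have hne : (Set.range (chartMap k h0)).Nonempty := ⟨_, ⟨genericPoint _, rfl⟩⟩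
      have ho : IsOpen (Set.range (chartMap k h0)) := by
        have : IsOpenImmersion (chartMap k h0) :=
          inferInstanceAs (IsOpenImmersion ((chartFunctor k Δ).map (homOfLE h0 : Δ.zeroCone ⟶ σ)))
        exact (chartMap k h0).isOpenEmbedding.isOpen_range
      obtain ⟨z, -, hz1, w, hw⟩ := PreirreducibleSpace.isPreirreducible_univ
        (X := affineChart k σ.1) _ _ (hU.preimage (chart k Δ σ).continuous) ho ⟨y, trivial, hy⟩
        (by simpa using hne)
      refine ⟨_, hz1, w, ?_⟩
      rw [← hw, ← Scheme.Hom.comp_apply, chartMap_chart]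
    rw [← hd]
    exact isPreirreducible_iff_closure.2 hT
  toNonempty := ⟨chart k Δ Δ.zeroCone (genericPoint _)⟩

instance : IsIntegral (toricVariety k Δ) := by
  have : AlgebraicGeometry.IsReduced (toricVariety k Δ) := by
    have (i : Δ.cones) : AlgebraicGeometry.IsReduced ((chartFunctor k Δ).obj i) :=
      inferInstanceAs (AlgebraicGeometry.IsReduced (affineChart k i.1))
    have h2 : ∀ i : Δ.cones, AlgebraicGeometry.IsReduced
        ((Scheme.IsLocallyDirected.openCover (chartFunctor k Δ)).X i) := fun i => this i
    exact @AlgebraicGeometry.IsReduced.of_openCover _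
      (Scheme.IsLocallyDirected.openCover (chartFunctor k Δ)) h2
  exact isIntegral_of_irreducibleSpace_of_isReduced _

instance : IsLocallyNoetherian (toricVariety k Δ) := by
  refine (isLocallyNoetherian_iff_openCover
    (Scheme.IsLocallyDirected.openCover (chartFunctor k Δ))).2 fun (i : Δ.cones) => ?_
  have : IsNoetherianRing (CoordRing k i.1) := isNoetherianRing_coordRing k (Δ.rational _ i.2)
  exact inferInstanceAs (IsLocallyNoetherian (Spec (.of (CoordRing k i.1))))

/-- The monomial `x^m`, `m ∈ M`, as a rational function on `X`: the germ at the generic point of the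
regular function `x^m` on the torus. -/
def monomial (m : M) : (toricVariety k Δ).functionField :=
  (toricVariety k Δ).presheaf.germ (chart k Δ Δ.zeroCone ''ᵁ ⊤) (genericPoint _) (by
      have : ((chart k Δ Δ.zeroCone ''ᵁ ⊤ : (toricVariety k Δ).Opens) :
          Set (toricVariety k Δ)).Nonempty :=
        ⟨_, genericPoint _, trivial, rfl⟩
      exact ((genericPoint_spec _).mem_open_set_iff (chart k Δ Δ.zeroCone ''ᵁ ⊤).isOpen).2
        (by simpa using this))
    (((chart k Δ Δ.zeroCone).appIso ⊤).inv
      ((Scheme.ΓSpecIso _).inv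
        (chi k Δ.zeroCone.1 ⟨m, fun v hv => by simp [(Submodule.mem_bot _).1 hv]⟩)))

instance (n : M →ₗ[ℤ] ℤ) : (orbitIdeal k n).IsPrime := by
  rw [orbitIdeal_eq_ker]; exact RingHom.ker_isPrime _

lemma height_orbitIdeal {n : M →ₗ[ℤ] ℤ} (hn : IsPrimitive n) : (orbitIdeal k n).height = 1 := by
  have hr : IsRationalPolyhedral (rayCone n) := ⟨{n}, by simp [rayCone]⟩
  have := isNoetherianRing_coordRing k hr
  obtain ⟨m, hm⟩ := hn.exists_apply_eq_one
  have hp : (orbitIdeal k n).IsPrime := inferInstance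
  rw [orbitIdeal_eq_span k ⟨m, mem_dualMonoid_rayCone.2 (by omega)⟩ hm] at hp ⊢
  refine Ideal.height_span_singleton_eq_one_of_mem_nonZeroDivisors ?_ ?_
  · exact mem_nonZeroDivisors_of_ne_zero (by simp [chi])
  · exact fun hu => hp.ne_top (Ideal.span_singleton_eq_top.2 hu)

/-- The generic point of the closed torus orbit of `U_ρ`. -/
def orbitPoint (n : M →ₗ[ℤ] ℤ) : affineChart k (rayCone n) :=
  (⟨orbitIdeal k n, inferInstance⟩ : PrimeSpectrum (CoordRing k (rayCone n)))

lemma coheight_orbitPoint {n : M →ₗ[ℤ] ℤ} (hn : IsPrimitive n) :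
    Order.coheight (orbitPoint k n) = 1 :=
  (idealHeight_eq_coheight (.of (CoordRing k (rayCone n))) (orbitPoint k n)).symm.trans
    (height_orbitIdeal k hn)

/-- The torus invariant prime divisor `D_ρ`, given by its generic point: the generic point of the
closed torus orbit of `U_ρ`. -/
def rayDivisor {Δ : Fan M} (ρ : Δ.Ray) : PrimeDivisor (toricVariety k Δ) :=
  ⟨chart k Δ ρ.cone (orbitPoint k ρ.1),
    (coheight_eq_of_isOpenImmersion (chart k Δ ρ.cone)).trans (coheight_orbitPoint k ρ.2.1)⟩

end Lattice

end Charts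
end Fan
end

end WeilDeco

/-! Both parts rest on a local normal form for the decoration. Since `X` is normal, the local ring
at a prime divisor `P` is a discrete valuation ring. If `P = D_ρ`, lift `h(ρ)` to a unit `t` of that
ring. Then `(f/g)(P) = h(ρ)` means `ord_P(f/g - t) ≥ 1`, and the prescribed coefficient equals `min
(ord_P(f - t g)) (ord_P(g) + 1)` (`min_ordTop_sub_mul`). This is the order function of a lattice: as
`(f, g) = (f - t g)(1, 0) + g (t, 1)`, it gives `(1, 0)` order `0` and `(t, 1)` order `1`. The
axioms of a pre-Weil decoration follow from those of a valuation; the coefficients have finite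
support because there are finitely many rays.

Two properties of the decoration then suffice. `HasBoundedPoles`: sections have at most simple
poles, only along the `D_ρ`. Over an affine open set they therefore embed in a finitely generated
module over a noetherian ring, and poles outside a basic open set `D(f)` are removed by powers of
`f`; this gives coherence. `IsLocallyTrivial`: near each prime divisor the sections are the vectors
with regular coordinates in a suitable basis. By Hartogs (`exists_germAt_eq`) a functional on `K²`
that is regular in codimension one on sections is a section of the dual. A section of the double
dual is evaluation at some vector of `K²`; testing it on the local coordinate functionals shows that
this vector has nonnegative coefficients, so the sheaf is reflexive. The generic stalk is `K²`,
whence the rank.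

The toric input is that `X` is normal and quasi-compact, and that there are finitely many rays, with
distinct divisors. Part (ii) reduces to part (i): `⟨u_ρ, ρ⟩ = 0` makes both `x^{u_ρ}` and its
inverse regular on `U_ρ`, so the value at `D_ρ` is a unit. -/

namespace WeilDeco

noncomputable section

/-! ### Orders of vanishing along prime divisors -/

section Order
variable {X : Scheme.{u}} [IsIntegral X]

lemma germToFunctionField_eq_algebraMap {U : X.Opens} [Nonempty U] {x : X} (hx : x ∈ U)
    (a : Γ(X, U)) : X.germToFunctionField U a =
      algebraMap (X.presheaf.stalk x) X.functionField (X.presheaf.germ U x hx a) :=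
  (Scheme.algebraMap_germ_eq_germToFunctionField X hx a).symm

/-- Otherwise `P`, `y` and the generic point form a strict chain, and `P` has codimension at least
two. -/
lemma PrimeDivisor.eq_of_specializes {P : PrimeDivisor X} {y : X} (h : y ⤳ P.1)
    (hy : y ≠ genericPoint X) : y = P.1 := by
  by_contra hne
  have hlt : P.1 < y := lt_of_le_not_ge h fun h' => hne (h.antisymm h').eq
  have hlt' : y < genericPoint X :=
    lt_of_le_not_ge (genericPoint_specializes y) fun h' => hy
      (Specializes.antisymm h' (genericPoint_specializes y)).eq
  have h1 : Order.coheight y + 1 ≤ Order.coheight P.1 := Order.coheight_add_one_le hlt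
  have h2 : Order.coheight (genericPoint X) + 1 ≤ Order.coheight y := Order.coheight_add_one_le hlt'
  rw [P.2] at h1
  have : (1 : ℕ∞) + 1 ≤ 1 := le_trans (by gcongr; exact le_trans le_add_self h2) h1
  norm_num at this

lemma PrimeDivisor.ne_genericPoint (P : PrimeDivisor X) : P.1 ≠ genericPoint X := by
  intro h
  have h1 := P.2
  have : Order.coheight (genericPoint X) = 0 := Order.coheight_eq_zero.2 fun y _ =>
    genericPoint_specializes y
  rw [h, this] at h1
  exact zero_ne_one h1

/-- An open neighbourhood of a prime divisor that meets no other prime divisor of a given finite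
set. -/
lemma exists_open_avoiding (P : PrimeDivisor X) {S : Set (PrimeDivisor X)} (hS : S.Finite) :
    ∃ U : X.Opens, P.1 ∈ U ∧ ∀ Q : PrimeDivisor X, Q.1 ∈ U → Q ∈ S → Q = P := by
  refine ⟨⟨(⋃ Q ∈ S \ {P}, closure {Q.1})ᶜ,
    ((hS.subset Set.sdiff_subset).isClosed_biUnion fun _ _ => isClosed_closure).isOpen_compl⟩,
    ?_, fun Q hQ hQS => ?_⟩
  · change P.1 ∉ _
    simp only [Set.mem_iUnion, not_exists]
    intro Q hQ h
    exact hQ.2 (Subtype.ext (P.eq_of_specializes (specializes_iff_mem_closure.2 h)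
      Q.ne_genericPoint))
  · by_contra hne
    exact hQ (Set.mem_biUnion (show Q ∈ S \ {P} from ⟨hQS, hne⟩) (subset_closure rfl))

variable [IsLocallyNoetherian X]

lemma ordTop_zero (P : PrimeDivisor X) : ordTop P 0 = ⊤ := if_pos rfl

lemma ordTop_of_ne {P : PrimeDivisor X} {f : X.functionField} (hf : f ≠ 0) :
    ordTop P f = (Scheme.ord f P.1 : ℤ) := if_neg hf

lemma ordTop_eq_top_iff {P : PrimeDivisor X} {f : X.functionField} : ordTop P f = ⊤ ↔ f = 0 := by
  unfold ordTop; split_ifs with h <;> simp [h]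

lemma ordTop_mul (P : PrimeDivisor X) (f g : X.functionField) :
    ordTop P (f * g) = ordTop P f + ordTop P g := by
  by_cases hf : f = 0
  · simp [hf, ordTop_zero]
  by_cases hg : g = 0
  · simp [hg, ordTop_zero]
  rw [ordTop_of_ne hf, ordTop_of_ne hg, ordTop_of_ne (mul_ne_zero hf hg), Scheme.ord_mul hf hg]
  rfl

lemma ordTop_one (P : PrimeDivisor X) : ordTop P 1 = 0 := by
  rw [ordTop_of_ne one_ne_zero]
  have h := Scheme.ord_mul (x := P.1) (one_ne_zero (α := X.functionField)) one_ne_zero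
  rw [mul_one] at h
  have : Scheme.ord (1 : X.functionField) P.1 = 0 := by omega
  rw [this]; rfl

lemma ordTop_pow (P : PrimeDivisor X) (f : X.functionField) (n : ℕ) :
    ordTop P (f ^ n) = n • ordTop P f := by
  induction n with
  | zero => simp [ordTop_one]
  | succ n ih => rw [pow_succ, ordTop_mul, ih, succ_nsmul]

lemma ordTop_algebraMap_nonneg (P : PrimeDivisor X) (a : X.presheaf.stalk P.1) :
    0 ≤ ordTop P (algebraMap _ X.functionField a) := by
  by_cases ha : a = 0
  · simp [ha, ordTop_zero]
  have h0 : algebraMap _ X.functionField a ≠ 0 := by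
    rwa [Ne, IsFractionRing.to_map_eq_zero_iff (K := X.functionField)]
  have : Ring.KrullDimLE 1 (X.presheaf.stalk P.1) := krullDimLE_of_coheight_le P.2.le
  rw [ordTop_of_ne h0]
  have : (0 : ℤ) ≤ Scheme.ord (algebraMap _ X.functionField a) P.1 :=
    (Scheme.le_ord_iff P.2 h0).2 (Ring.ordFrac_ge_one_of_ne_zero (K := X.functionField) ha)
  exact_mod_cast this

lemma ordTop_of_isUnit (P : PrimeDivisor X) {a : X.presheaf.stalk P.1} (ha : IsUnit a) :
    ordTop P (algebraMap _ X.functionField a) = 0 := by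
  obtain ⟨u, rfl⟩ := ha
  have h1 := ordTop_algebraMap_nonneg P (u : X.presheaf.stalk P.1)
  have h2 := ordTop_algebraMap_nonneg P ((u⁻¹ : (X.presheaf.stalk P.1)ˣ) : X.presheaf.stalk P.1)
  have h3 := ordTop_mul P (algebraMap _ X.functionField (u : X.presheaf.stalk P.1))
    (algebraMap _ X.functionField ((u⁻¹ : (X.presheaf.stalk P.1)ˣ) : X.presheaf.stalk P.1))
  rw [← map_mul, Units.mul_inv, map_one, ordTop_one] at h3
  revert h1 h2 h3
  generalize ordTop P _ = x
  generalize ordTop P _ = y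
  intro h1 h2 h3
  cases x <;> cases y <;> norm_cast at *
  omega

section DVR
variable [∀ x : X, IsIntegrallyClosed (X.presheaf.stalk x)]

/-- The stalk is a noetherian normal local domain of dimension one, hence Dedekind and local. -/
instance isDiscreteValuationRing_stalk (P : PrimeDivisor X) :
    IsDiscreteValuationRing (X.presheaf.stalk P.1) := by
  have hd : ringKrullDim (X.presheaf.stalk P.1) = 1 := by
    rw [ringKrullDim_stalk_eq_coheight, P.2]; rfl
  have hf : ¬ IsField (X.presheaf.stalk P.1) := fun h => by
    rw [ringKrullDim_eq_zero_of_isField h] at hd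
    exact zero_ne_one hd
  have : Ring.KrullDimLE 1 (X.presheaf.stalk P.1) := krullDimLE_of_coheight_le P.2.le
  have : IsDedekindDomain (X.presheaf.stalk P.1) :=
    { maximalOfPrime := fun h0 hp => hp.isMaximal_of_ne_bot h0 }
  exact ((IsDiscreteValuationRing.TFAE _ hf).out 2 0).1 this

lemma inf_le_ordTop_add (P : PrimeDivisor X) (f g : X.functionField) :
    min (ordTop P f) (ordTop P g) ≤ ordTop P (f + g) := by
  by_cases hf : f = 0
  · simp [hf]
  by_cases hg : g = 0
  · simp [hg]
  by_cases hfg : f + g = 0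
  · simp [hfg, ordTop_zero]
  rw [ordTop_of_ne hf, ordTop_of_ne hg, ordTop_of_ne hfg]
  have := Scheme.ord_add (x := P.1) hfg
  exact_mod_cast this

/-- In a valuation ring `f` or `f⁻¹` is integral. If `f⁻¹` is, then both have nonnegative order and
the orders sum to `0`, so `f⁻¹` has order `0` and is a unit of the stalk. -/
lemma ordTop_nonneg_iff {P : PrimeDivisor X} {f : X.functionField} :
    0 ≤ ordTop P f ↔ ∃ a : X.presheaf.stalk P.1, algebraMap _ X.functionField a = f := by
  refine ⟨fun h => ?_, fun ⟨a, ha⟩ => ha ▸ ordTop_algebraMap_nonneg P a⟩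
  by_cases hf : f = 0
  · exact ⟨0, by simp [hf]⟩
  rcases ValuationRing.isInteger_or_isInteger (X.presheaf.stalk P.1) f with ha | ⟨a, ha⟩
  · exact ha
  by_cases hu : IsUnit a
  · obtain ⟨u, rfl⟩ := hu
    refine ⟨((u⁻¹ : (X.presheaf.stalk P.1)ˣ) : X.presheaf.stalk P.1), ?_⟩
    rw [eq_comm, ← inv_inj, ← ha]
    refine eq_inv_of_mul_eq_one_left ?_
    rw [← map_mul, Units.mul_inv, map_one]
  · exfalso
    have : Ring.KrullDimLE 1 (X.presheaf.stalk P.1) := krullDimLE_of_coheight_le P.2.le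
    have h1 := ordTop_mul P f f⁻¹
    rw [mul_inv_cancel₀ hf, ordTop_one, ← ha] at h1
    have h2 := ordTop_algebraMap_nonneg P a
    have h3 : ordTop P (algebraMap _ X.functionField a) = 0 := by
      revert h h1 h2
      generalize ordTop P f = x
      generalize ordTop P _ = y
      intro h1 h2 h3
      cases x <;> cases y <;> norm_cast at *
      omega
    have h0 : algebraMap _ X.functionField a ≠ 0 := by
      rw [ha]; exact inv_ne_zero hf
    rw [ordTop_of_ne h0] at h3
    have h4 : Scheme.ord (algebraMap _ X.functionField a) P.1 = 0 := by exact_mod_cast h3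
    rw [Scheme.ord_eq_iff P.2 h0] at h4
    exact hu (Ring.isUnit_iff_ordFrac_one_of_isDiscreteValuationRing (K := X.functionField).2 h4)

lemma ordTop_eq_zero_iff {P : PrimeDivisor X} {a : X.presheaf.stalk P.1} :
    ordTop P (algebraMap _ X.functionField a) = 0 ↔ IsUnit a := by
  refine ⟨fun h => ?_, ordTop_of_isUnit P⟩
  have h0 : algebraMap _ X.functionField a ≠ 0 := fun h0 => by
    rw [h0, ordTop_zero] at h; exact absurd h (by simp)
  obtain ⟨b, hb⟩ : ∃ b, algebraMap (X.presheaf.stalk P.1) X.functionField b =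
      (algebraMap _ X.functionField a)⁻¹ := by
    refine ordTop_nonneg_iff.1 ?_
    have h1 := ordTop_mul P (algebraMap _ X.functionField a) (algebraMap _ X.functionField a)⁻¹
    rw [mul_inv_cancel₀ h0, ordTop_one, h, zero_add] at h1
    exact h1.le
  refine IsUnit.of_mul_eq_one b (IsFractionRing.injective (X.presheaf.stalk P.1) X.functionField ?_)
  rw [map_mul, hb, mul_inv_cancel₀ h0, map_one]

lemma one_le_ordTop_iff {P : PrimeDivisor X} {a : X.presheaf.stalk P.1} :
    1 ≤ ordTop P (algebraMap _ X.functionField a) ↔ X.residue P.1 a = 0 := by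
  have h1 : X.residue P.1 a = 0 ↔ ¬ IsUnit a := IsLocalRing.residue_eq_zero_iff a
  rw [h1, ← ordTop_eq_zero_iff]
  have := ordTop_algebraMap_nonneg P a
  revert this
  generalize ordTop P _ = x
  intro h
  cases x
  · simp
  · norm_cast at *; omega

lemma exists_ordTop_eq_one (P : PrimeDivisor X) : ∃ π : X.functionField, ordTop P π = 1 := by
  obtain ⟨ϖ, hϖ⟩ := IsDiscreteValuationRing.exists_irreducible (X.presheaf.stalk P.1)
  have h0 : algebraMap _ X.functionField ϖ ≠ 0 := by
    rw [Ne, IsFractionRing.to_map_eq_zero_iff (K := X.functionField)]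
    exact hϖ.ne_zero
  have : Ring.KrullDimLE 1 (X.presheaf.stalk P.1) := krullDimLE_of_coheight_le P.2.le
  refine ⟨algebraMap _ _ ϖ, ?_⟩
  rw [ordTop_of_ne h0, (Scheme.ord_eq_iff P.2 h0 (n := 1)).2]
  · rfl
  · exact Ring.ordFrac_irreducible (K := X.functionField) hϖ

end DVR

/-! ### Finiteness of the support of a principal divisor -/

section Support

/-- By codimension one, a prime divisor missing `U` is the generic point of an irreducible component
of the complement, and there are finitely many components. -/
lemma finite_primeDivisor_not_mem [CompactSpace X] (U : X.Opens) [Nonempty U] :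
    {P : PrimeDivisor X | P.1 ∉ U}.Finite := by
  have : IsNoetherian X := {}
  obtain ⟨S, hS, hS1, hS2⟩ := NoetherianSpace.exists_finite_set_isClosed_irreducible
    (α := X) (s := (U : Set X)ᶜ) U.isOpen.isClosed_compl
  refine Set.Finite.of_finite_image (f := fun P : PrimeDivisor X => closure {P.1})
    (hS.subset ?_) (fun P _ Q _ h => Subtype.ext ?_)
  · rintro _ ⟨P, hP, rfl⟩
    have hP' : P.1 ∈ (U : Set X)ᶜ := hP
    rw [hS2.2] at hP'
    obtain ⟨C, hC, hPC⟩ := hP'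
    obtain ⟨y, hy⟩ := QuasiSober.sober (hS2.1 C hC) (hS1 C hC)
    have hyC : y ∈ C := hy.mem
    have : y = P.1 := P.eq_of_specializes (hy.specializes hPC) fun h => by
      have h1 : y ∈ (U : Set X)ᶜ := by rw [hS2.2]; exact ⟨C, hC, hyC⟩
      refine h1 ?_
      rw [h]
      exact ((genericPoint_spec X).mem_open_set_iff U.isOpen).2 (by simpa using ‹Nonempty U›)
    change closure {P.1} ∈ S
    rw [← this, hy.def]; exact hC
  · exact Inseparable.eq (inseparable_iff_closure_eq.2 h)

lemma finite_ordTop_ne_zero [CompactSpace X] {f : X.functionField} (hf : f ≠ 0) :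
    {P : PrimeDivisor X | ordTop P f ≠ 0}.Finite := by
  obtain ⟨U, -, a, hU, rfl, ha⟩ := exists_isUnit_germ_eq X f hf
  refine (finite_primeDivisor_not_mem U).subset fun P hP hPU => hP ?_
  rw [germToFunctionField_eq_algebraMap hPU]
  exact ordTop_of_isUnit P (ha.map _)

end Support

end Order

/-! ### Regularity of rational functions in codimension one -/

section Hartogs

/-- A Noetherian integrally closed domain is the intersection of its localizations at the primes of
height one. -/
lemma exists_algebraMap_eq_of_height_one {A K : Type*} [CommRing A] [IsDomain A]
    [IsNoetherianRing A] [IsIntegrallyClosed A] [Field K] [Algebra A K] [IsFractionRing A K] (x : K)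
    (hx : ∀ p : Ideal A, p.IsPrime → p.height = 1 →
      ∃ s ∉ p, ∃ a, algebraMap A K s * x = algebraMap A K a) :
    ∃ a, algebraMap A K a = x := by
  by_contra hcon
  let I : K → Ideal A := fun y =>
    { carrier := {r | ∃ a, algebraMap A K r * y = algebraMap A K a}
      zero_mem' := ⟨0, by simp⟩
      add_mem' := by
        rintro r s ⟨a, ha⟩ ⟨b, hb⟩
        exact ⟨a + b, by rw [map_add, map_add, add_mul, ha, hb]⟩
      smul_mem' := by
        rintro c r ⟨a, ha⟩
        exact ⟨c * a, by rw [smul_eq_mul, map_mul, map_mul, mul_assoc, ha]⟩ }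
  have hI : ∀ y r, r ∈ I y ↔ ∃ a, algebraMap A K r * y = algebraMap A K a := fun _ _ => Iff.rfl
  have h1 : ∀ y, 1 ∈ I y ↔ ∃ a, algebraMap A K a = y := fun y => by
    rw [hI, map_one, one_mul]; exact exists_congr fun _ => eq_comm
  -- `I y` is the ideal of denominators of `y`. Take one that is maximal among the proper ideals `I
  -- (c x)`; it will turn out to be a prime of height one.
  obtain ⟨p, ⟨c, hc, hcp⟩, hmax⟩ := set_has_maximal_iff_noetherian.2
    (inferInstance : IsNoetherian A A)
    {J | ∃ c : A, 1 ∉ I (algebraMap A K c * x) ∧ J = I (algebraMap A K c * x)}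
    ⟨_, 1, by rw [map_one, one_mul, h1]; exact hcon, rfl⟩
  obtain ⟨y, hy⟩ : ∃ y, y = algebraMap A K c * x := ⟨_, rfl⟩
  rw [← hy] at hc hcp
  subst hcp
  have hprime : (I y).IsPrime := by
    -- If `r s ∈ I y` and `s ∉ I y`, then `I (s y)` is proper and contains `I y`, so the two are
    -- equal by maximality; but `r ∈ I (s y)`.
    refine Ideal.isPrime_iff.2 ⟨(Ideal.ne_top_iff_one _).2 hc, fun {r s} hrs => ?_⟩
    by_contra! hcon2
    have hs1 : 1 ∉ I (algebraMap A K (s * c) * x) := fun h => hcon2.2 (by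
      obtain ⟨a, ha⟩ := h
      refine ⟨a, ?_⟩
      rw [hy, ← mul_assoc, ← map_mul, ← ha, map_one, one_mul])
    refine hmax _ ⟨s * c, hs1, rfl⟩ (lt_of_le_of_ne ?_ fun h => hcon2.1 ?_)
    · rintro t ⟨a, ha⟩
      exact ⟨s * a, by rw [map_mul, map_mul, ← ha, hy]; ring⟩
    · obtain ⟨a, ha⟩ := hrs
      rw [h]
      exact ⟨a, by rw [← ha, hy, map_mul, map_mul]; ring⟩
  have hne : I y ≠ ⊥ := by
    obtain ⟨a, b, hb, hab⟩ := IsFractionRing.div_surjective (A := A) y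
    refine (Submodule.ne_bot_iff _).2 ⟨b, ⟨a, ?_⟩, nonZeroDivisors.ne_zero hb⟩
    rw [← hab, mul_div_cancel₀]
    rw [Ne, IsFractionRing.to_map_eq_zero_iff (K := K)]
    exact nonZeroDivisors.ne_zero hb
  obtain ⟨t, ht, s, hs, hts⟩ : ∃ t ∈ I y, ∃ s ∉ I y, algebraMap A K t * y = algebraMap A K s := by
    -- Otherwise multiplication by `y` maps the nonzero finitely generated ideal `I y` into itself,
    -- so `y` is integral over `A` and hence lies in `A`.
    by_contra! hcon2
    refine hc ((h1 y).2 (IsIntegrallyClosed.isIntegral_iff.1 ?_))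
    refine isIntegral_of_smul_mem_submodule (R := A) (M := K)
      (Submodule.map (Algebra.linearMap A K) (I y)) ?_ ?_ y ?_
    · rw [Submodule.ne_bot_iff] at hne ⊢
      obtain ⟨r, hr, hr0⟩ := hne
      exact ⟨_, ⟨r, hr, rfl⟩, (IsFractionRing.to_map_eq_zero_iff (K := K)).not.2 hr0⟩
    · exact (IsNoetherian.noetherian _).map _
    · rintro _ ⟨r, hr, rfl⟩
      obtain ⟨a, ha⟩ := id hr
      by_cases haI : a ∈ I y
      · exact ⟨a, haI, by rw [smul_eq_mul, mul_comm, Algebra.linearMap_apply, Algebra.linearMap_apply, ha]⟩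
      · exact absurd ha (hcon2 r hr a haI)
  have hht : (I y).height = 1 := by
    -- For a prime `q` with `t ∈ q ⊆ I y` and `r ∈ I y`, the identity `r s = (r y) t` puts `r s` in
    -- `q`, and `s ∉ q`. Krull's principal ideal theorem then bounds the height.
    have hmin : I y ∈ (Ideal.span {t}).minimalPrimes := by
      refine ⟨⟨hprime, (Ideal.span_singleton_le_iff_mem _).2 ht⟩, ?_⟩
      rintro q ⟨hq, htq⟩ hqp r ⟨a, ha⟩
      rw [Ideal.span_singleton_le_iff_mem] at htq
      refine (hq.mem_or_mem (?_ : r * s ∈ q)).resolve_right fun h => hs (hqp h)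
      have : r * s = a * t := by
        apply IsFractionRing.injective A K
        rw [map_mul, map_mul, ← ha, ← hts]; ring
      rw [this]
      exact q.mul_mem_left _ htq
    refine le_antisymm (Ideal.height_le_one_of_isPrincipal_of_mem_minimalPrimes _ _ hmin) ?_
    rw [Order.one_le_iff_ne_zero]
    intro h0
    rw [Ideal.height_eq_zero_iff, IsDomain.minimalPrimes_eq_singleton_bot] at h0
    exact hne h0
  -- A denominator of `x` outside `I y` is also a denominator of `y = c x`, which is absurd.
  obtain ⟨s', hs', a, ha⟩ := hx _ hprime hht
  refine hs' ⟨c * a, ?_⟩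
  rw [hy, map_mul, ← ha]; ring

variable {X : Scheme.{u}} [IsIntegral X]

lemma section_ext {V : X.Opens} {a b : Γ(X, V)}
    (h : ∀ x : V, (germAt x a : X.functionField) = germAt x b) : a = b := by
  refine TopCat.Presheaf.section_ext X.sheaf V a b fun x hx => ?_
  have : Nonempty V := ⟨⟨x, hx⟩⟩
  rw [Scheme.germToFunctionField_injective X V (h ⟨x, hx⟩)]

lemma germAt_eq_algebraMap {U : X.Opens} (x : U) {y : X} (hy : y ∈ U) (a : Γ(X, U)) :
    (germAt x a : X.functionField) =
      algebraMap (X.presheaf.stalk y) X.functionField (X.presheaf.germ U y hy a) :=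
  haveI : Nonempty U := ⟨x⟩
  germToFunctionField_eq_algebraMap hy a

lemma germAt_injective {U : X.Opens} (x : U) :
    Function.Injective (germAt x : Γ(X, U) →+* X.functionField) :=
  haveI : Nonempty U := ⟨x⟩
  Scheme.germToFunctionField_injective X U

lemma exists_germAt_eq_of_cover (f : X.functionField) (V : X.Opens)
    (h : ∀ x ∈ V, ∃ U : X.Opens, x ∈ U ∧ U ≤ V ∧ ∃ a : Γ(X, U), ∀ y : U, germAt y a = f) :
    ∃ a : Γ(X, V), ∀ x : V, germAt x a = f := by
  choose U hxU hUV a ha using h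
  obtain ⟨s, hs, -⟩ := X.sheaf.existsUnique_gluing' (fun x : V => U x.1 x.2) V
    (fun x => homOfLE (hUV _ _)) (fun x hx => Opens.mem_iSup.2 ⟨⟨x, hx⟩, hxU x hx⟩)
    (fun x => a x.1 x.2) (fun x y => by
      refine section_ext (X := X) fun z => ?_
      refine (germAt_map (inf_le_left) z _).trans (((ha _ _ _).trans (ha _ _ _).symm).trans
        (germAt_map (inf_le_right) z _).symm))
  refine ⟨s, fun x => ?_⟩
  have h1 := hs x
  have h2 := germAt_map (hUV x.1 x.2) ⟨x.1, hxU x.1 x.2⟩ s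
  rw [← h2]
  exact (congrArg _ h1).trans (ha _ _ _)

/-- Normality is checked at maximal ideals, where the localizations are stalks of `X`. -/
lemma isIntegrallyClosed_of_isAffineOpen
    [∀ x : X, IsIntegrallyClosed (X.presheaf.stalk x)] {U : X.Opens} (hU : IsAffineOpen U) [Nonempty U] :
    IsIntegrallyClosed Γ(X, U) := by
  refine IsIntegrallyClosed.of_localization_maximal fun p _ _ => ?_
  let q : PrimeSpectrum Γ(X, U) := ⟨p, inferInstance⟩
  have hx : hU.fromSpec q ∈ U := by
    rw [← SetLike.mem_coe, ← hU.range_fromSpec]; exact ⟨q, rfl⟩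
  let := TopCat.Presheaf.algebra_section_stalk X.presheaf ⟨_, hx⟩
  have : IsLocalization.AtPrime (X.presheaf.stalk (hU.fromSpec q)) p := hU.isLocalization_stalk' q hx
  exact .of_equiv (IsLocalization.algEquiv p.primeCompl (X.presheaf.stalk (hU.fromSpec q))
    (Localization.AtPrime p)).toRingEquiv

variable [IsLocallyNoetherian X]

lemma ordTop_germAt_nonneg (P : PrimeDivisor X) {U : X.Opens} (x : U) (hP : P.1 ∈ U)
    (a : Γ(X, U)) : 0 ≤ ordTop P (germAt x a) :=
  haveI : Nonempty U := ⟨x⟩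
  ordTop_germ_nonneg P hP a

variable [∀ x : X, IsIntegrallyClosed (X.presheaf.stalk x)]

lemma exists_germAt_eq_of_isAffineOpen {U : X.Opens} (hU : IsAffineOpen U) [Nonempty U]
    (f : X.functionField) (h : ∀ P : PrimeDivisor X, P.1 ∈ U → 0 ≤ ordTop P f) :
    ∃ a : Γ(X, U), X.germToFunctionField U a = f := by
  have := functionField_isFractionRing_of_isAffineOpen X U hU
  have := isIntegrallyClosed_of_isAffineOpen hU
  have : IsNoetherianRing Γ(X, U) := IsLocallyNoetherian.component_noetherian ⟨U, hU⟩
  -- Primes of height one of `Γ(X, U)` are the prime divisors of `X` in `U`; regularity in the stalk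
  -- there supplies the denominator.
  refine exists_algebraMap_eq_of_height_one (A := Γ(X, U)) f fun p hp hht => ?_
  let q : PrimeSpectrum Γ(X, U) := ⟨p, hp⟩
  have hx : hU.fromSpec q ∈ U := by
    rw [← SetLike.mem_coe, ← hU.range_fromSpec]; exact ⟨q, rfl⟩
  have hco : Order.coheight (hU.fromSpec q) = 1 :=
    (coheight_eq_of_isOpenImmersion hU.fromSpec).trans
      ((idealHeight_eq_coheight Γ(X, U) q).symm.trans hht)
  obtain ⟨b, hb⟩ := ordTop_nonneg_iff.1 (h ⟨_, hco⟩ hx)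
  let := TopCat.Presheaf.algebra_section_stalk X.presheaf ⟨_, hx⟩
  have : IsLocalization.AtPrime (X.presheaf.stalk (hU.fromSpec q)) p := hU.isLocalization_stalk' q hx
  obtain ⟨⟨r, s⟩, hrs⟩ := IsLocalization.surj p.primeCompl b
  refine ⟨s.1, s.2, r, ?_⟩
  have h1 := congrArg (algebraMap (X.presheaf.stalk (hU.fromSpec q)) X.functionField) hrs
  rw [map_mul, hb] at h1
  have h2 : ∀ t : Γ(X, U), algebraMap Γ(X, U) X.functionField t =
      algebraMap (X.presheaf.stalk (hU.fromSpec q)) X.functionField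
        (algebraMap Γ(X, U) (X.presheaf.stalk (hU.fromSpec q)) t) :=
    fun t => germToFunctionField_eq_algebraMap hx t
  rw [h2, h2, mul_comm]
  exact h1

/-- On a normal scheme, a rational function without poles along prime divisors is regular. -/
lemma exists_germAt_eq (f : X.functionField) (V : X.Opens)
    (h : ∀ P : PrimeDivisor X, P.1 ∈ V → 0 ≤ ordTop P f) :
    ∃ a : Γ(X, V), ∀ x : V, germAt x a = f := by
  refine exists_germAt_eq_of_cover f V fun x hx => ?_
  obtain ⟨_, ⟨U, hU, rfl⟩, hxU, hUV⟩ := X.isBasis_affineOpens.exists_subset_of_mem_open hx V.isOpen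
  have : Nonempty U := ⟨⟨x, hxU⟩⟩
  obtain ⟨a, ha⟩ := exists_germAt_eq_of_isAffineOpen hU f fun P hP => h P (hUV hP)
  exact ⟨U, hxU, hUV, a, fun _ => ha⟩

end Hartogs

/-! ### Sheaves of constant vectors and their duals -/

section GenericFiber
variable {X : Scheme.{u}} [IsIntegral X]

/-- A realization of a presheaf of modules as a presheaf of constant functions with values in a vector
space over the function field, every vector of which occurs on small open sets. -/
structure GenericFiber (P : X.PresheafOfModules) (E : Type u) [AddCommGroup E]
    [Module X.functionField E] where
  val : ∀ {V : X.Opens}, V → P.obj (op V) → E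
  val_add : ∀ {V : X.Opens} (x : V) (s t : P.obj (op V)), val x (s + t) = val x s + val x t
  val_smul : ∀ {V : X.Opens} (x : V) (a : Γ(X, V)) (s : P.obj (op V)),
    val x (a • s) = germAt x a • val x s
  val_res : ∀ {V W : X.Opens} (h : W ≤ V) (x : W) (s : P.obj (op V)),
    val x (P.restrictₛₗ (homOfLE h).op s) = val ⟨x.1, h x.2⟩ s
  val_eq : ∀ {V : X.Opens} (x y : V) (s : P.obj (op V)), val x s = val y s
  ext : ∀ {V : X.Opens} (s t : P.obj (op V)), (∀ x, val x s = val x t) → s = t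
  spread : ∀ (e : E) (U : X.Opens) (_ : U), ∃ V ≤ U, ∃ (y : V) (s : P.obj (op V)), val y s = e

lemma exists_germAt_eq_of_functionField (c : X.functionField) :
    ∃ (V : X.Opens) (y : V) (a : Γ(X, V)), germAt y a = c := by
  obtain ⟨V, hV, a, ha⟩ := X.presheaf.exists_germ_eq c
  exact ⟨V, ⟨_, hV⟩, a, ha⟩

lemma exists_mem_inf {V W : X.Opens} (x : V) (y : W) : Nonempty (V ⊓ W : X.Opens) := by
  obtain ⟨z, hz⟩ := nonempty_preirreducible_inter V.isOpen W.isOpen ⟨x.1, x.2⟩ ⟨y.1, y.2⟩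
  exact ⟨z, hz⟩

namespace GenericFiber
variable {P : X.PresheafOfModules} {E : Type u} [AddCommGroup E] [Module X.functionField E]
  (G : GenericFiber P E)

/-- Sections with the same value agree on the overlap of their domains, which is non-empty by
irreducibility; compatibility with restriction does the rest. -/
lemma germAt_app_eq {U : X.Opens} (φ : DualSection P U) {V W : X.Opens} (hV : V ≤ U) (hW : W ≤ U)
    (x : V) (y : W) (s : P.obj (op V)) (t : P.obj (op W)) (h : G.val x s = G.val y t) :
    (germAt x (φ.app V hV s) : X.functionField) = germAt y (φ.app W hW t) := by
  obtain ⟨z, hz⟩ := exists_mem_inf x y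
  let z : ↥(V ⊓ W) := ⟨z, hz⟩
  have hst : P.restrictₛₗ (homOfLE (inf_le_left : V ⊓ W ≤ V)).op s =
      P.restrictₛₗ (homOfLE (inf_le_right : V ⊓ W ≤ W)).op t := by
    refine G.ext _ _ fun w => ?_
    rw [G.val_res, G.val_res, G.val_eq _ x, h]; exact G.val_eq _ _ _
  have h1 := germAt_map (inf_le_left : V ⊓ W ≤ V) z (φ.app V hV s)
  have h2 := germAt_map (inf_le_right : V ⊓ W ≤ W) z (φ.app W hW t)
  rw [φ.compat] at h1 h2
  rw [hst] at h1
  exact h1.symm.trans h2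

/-- A section of the dual over a non-empty open set is given by a linear functional on the generic
fiber. -/
lemma exists_functional {U : X.Opens} (x₀ : U) (φ : DualSection P U) :
    ∃ l : E →ₗ[X.functionField] X.functionField, ∀ (V : X.Opens) (hV : V ≤ U) (y : V)
      (s : P.obj (op V)), germAt y (φ.app V hV s) = l (G.val y s) := by
  -- The functional sends `e` to the value of `φ` on any section realizing `e`; by `key` the choice
  -- does not matter.
  choose V hV y s hs using fun e => G.spread e U x₀
  have key : ∀ (W : X.Opens) (hW : W ≤ U) (z : W) (t : P.obj (op W)) (e : E), G.val z t = e →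
      germAt z (φ.app W hW t) = germAt (y e) (φ.app (V e) (hV e) (s e)) := fun W hW z t e he =>
    G.germAt_app_eq φ _ _ _ _ _ _ (he.trans (hs e).symm)
  refine ⟨{ toFun := fun e => germAt (y e) (φ.app (V e) (hV e) (s e))
            map_add' := fun e f => ?_
            map_smul' := fun c e => ?_ }, fun W hW z t => key W hW z t _ rfl⟩
  · obtain ⟨z, hz⟩ := exists_mem_inf (y e) (y f)
    let z : ↥(V e ⊓ V f) := ⟨z, hz⟩
    have h1 := G.val_res (inf_le_left : V e ⊓ V f ≤ V e) z (s e)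
    have h2 := G.val_res (inf_le_right : V e ⊓ V f ≤ V f) z (s f)
    rw [G.val_eq _ (y e), hs] at h1
    rw [G.val_eq _ (y f), hs] at h2
    have hW : V e ⊓ V f ≤ U := inf_le_left.trans (hV e)
    rw [← key _ hW z _ e h1, ← key _ hW z _ f h2, ← map_add, ← map_add]
    exact (key _ hW z _ _ (by rw [G.val_add, h1, h2])).symm
  -- The scalar `c` is regular only on some `W`, so the comparison takes place on `V e ⊓ W`.
  · obtain ⟨W, w, a, ha⟩ := exists_germAt_eq_of_functionField c
    obtain ⟨z, hz⟩ := exists_mem_inf (y e) w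
    let z : ↥(V e ⊓ W) := ⟨z, hz⟩
    have h1 := G.val_res (inf_le_left : V e ⊓ W ≤ V e) z (s e)
    rw [G.val_eq _ (y e), hs] at h1
    have h2 := germAt_map (inf_le_right : V e ⊓ W ≤ W) z a
    rw [germAt_eq _ w, ha] at h2
    have hW : V e ⊓ W ≤ U := inf_le_left.trans (hV e)
    rw [← key _ hW z _ e h1, RingHom.id_apply, smul_eq_mul, ← h2, ← map_mul, ← smul_eq_mul,
      ← map_smul]
    refine (key _ hW z _ _ ?_).symm
    rw [G.val_smul, h1]

/-- The functional on the generic fiber given by a section of the dual. -/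
def functional {U : X.Opens} (x : U) (φ : DualSection P U) : E →ₗ[X.functionField] X.functionField :=
  (G.exists_functional x φ).choose

lemma functional_val {U : X.Opens} (x : U) (φ : DualSection P U) {V : X.Opens} (hV : V ≤ U) (y : V)
    (s : P.obj (op V)) : G.functional x φ (G.val y s) = germAt y (φ.app V hV s) :=
  ((G.exists_functional x φ).choose_spec V hV y s).symm

lemma functional_eq_of_forall {U : X.Opens} (x : U) (φ : DualSection P U)
    (l : E →ₗ[X.functionField] X.functionField)
    (h : ∀ (V : X.Opens) (hV : V ≤ U) (y : V) (s : P.obj (op V)),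
      l (G.val y s) = germAt y (φ.app V hV s)) : G.functional x φ = l := by
  ext e
  obtain ⟨V, hV, y, s, rfl⟩ := G.spread e U x
  rw [G.functional_val x φ hV, h V hV]

/-- The dual of a realized presheaf is realized in the dual vector space. -/
def dual (hspread : ∀ (l : Module.Dual X.functionField E) (U : X.Opens) (_ : U),
      ∃ V ≤ U, ∃ (y : V) (φ : DualSection P V), G.functional y φ = l) :
    GenericFiber (dual P) (Module.Dual X.functionField E) where
  val {V} x φ := G.functional x (show DualSection P V from φ)
  val_add {V} x φ ψ := by
    refine G.functional_eq_of_forall _ _ _ fun W hW y s => ?_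
    rw [LinearMap.add_apply, G.functional_val x _ hW, G.functional_val x _ hW, ← map_add]
    rfl
  val_smul {V} x a φ := by
    refine G.functional_eq_of_forall _ _ _ fun W hW y s => ?_
    rw [LinearMap.smul_apply, G.functional_val x _ hW, germAt_eq x ⟨y.1, hW y.2⟩,
      ← germAt_map hW y, smul_eq_mul, ← map_mul]
    rfl
  val_res {V W} h x φ := by
    refine G.functional_eq_of_forall _ _ _ fun W' hW' y s => ?_
    rw [G.functional_val _ _ (hW'.trans h)]
    rfl
  -- The existence statement behind `functional` does not mention the point, so both choices
  -- coincide by proof irrelevance.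
  val_eq x y φ := rfl
  ext {V} φ ψ h := by
    refine DualSection.ext (funext fun W => funext fun hW => LinearMap.ext fun s => ?_)
    refine section_ext fun x => ?_
    have := h ⟨x.1, hW x.2⟩
    rw [← G.functional_val ⟨x.1, hW x.2⟩ (show DualSection P V from φ) hW,
      ← G.functional_val ⟨x.1, hW x.2⟩ (show DualSection P V from ψ) hW, this]
  spread l U x := hspread l U x

/-- A realized presheaf is reflexive if it contains the vectors on which all regular functionals take
regular values. -/
lemma bijective_evalDual [Module.Finite X.functionField E]
    (hspread : ∀ (l : Module.Dual X.functionField E) (U : X.Opens) (_ : U),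
      ∃ V ≤ U, ∃ (y : V) (φ : DualSection P V), G.functional y φ = l)
    (U : X.Opens) (hmem : ∀ e : E, (∀ (V : X.Opens) (_ : V ≤ U) (y : V) (φ : DualSection P V),
      ∃ a : Γ(X, V), germAt y a = G.functional y φ e) →
      ∃ s : P.obj (op U), ∀ x, G.val x s = e) :
    Function.Bijective (evalDual (P := P) U) := by
  let G' := G.dual hspread
  have heval : ∀ (s : P.obj (op U)) (V : X.Opens) (hV : V ≤ U) (y : V) (φ : DualSection P V),
      germAt y ((evalDual U s).app V hV φ) = G.functional y φ (G.val ⟨y.1, hV y.2⟩ s) := by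
    intro s V hV y φ
    rw [← G.val_res hV, G.functional_val y φ le_rfl]
    rfl
  constructor
  · intro s t hst
    refine G.ext _ _ fun x => ?_
    -- Functionals separate vectors, and each functional comes from a section of the dual over a
    -- smaller open set.
    rw [← sub_eq_zero, ← Module.forall_dual_apply_eq_zero_iff X.functionField]
    intro l
    obtain ⟨V, hV, y, φ, rfl⟩ := hspread l U x
    rw [map_sub, sub_eq_zero]
    have h1 := heval s V hV y φ
    rw [hst, heval t] at h1
    rw [G.val_eq x ⟨y.1, hV y.2⟩ s, G.val_eq x ⟨y.1, hV y.2⟩ t, h1]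
  · intro Φ
    -- A section of the double dual gives a functional on the dual space, which by finite dimension
    -- is evaluation at a vector `e`. Over the empty set any vector will do.
    obtain ⟨e, he⟩ : ∃ e : E, ∀ (V : X.Opens) (hV : V ≤ U) (y : V) (φ : DualSection P V),
        germAt y (Φ.app V hV φ) = G.functional y φ e := by
      by_cases hU : Nonempty U
      · obtain ⟨x⟩ := hU
        refine ⟨(Module.evalEquiv X.functionField E).symm (G'.functional x Φ),
          fun V hV y φ => ?_⟩
        rw [Module.apply_evalEquiv_symm_apply]
        exact (G'.functional_val x Φ hV y φ).symm
      · exact ⟨0, fun V hV y => absurd ⟨⟨y.1, hV y.2⟩⟩ hU⟩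
    obtain ⟨s, hs⟩ := hmem e fun V hV y φ => ⟨_, he V hV y φ⟩
    refine ⟨s, DualSection.ext (funext fun V => funext fun hV => LinearMap.ext fun φ => ?_)⟩
    refine section_ext fun y => ?_
    rw [heval s V hV y φ, hs, he V hV y φ]

end GenericFiber

/-! ### The generic stalk and the rank -/

section Rank
variable {F : X.Modules} {E : Type u} [AddCommGroup E] [Module X.functionField E]

lemma mem_of_nonempty {V : X.Opens} (x : V) : genericPoint X ∈ V :=
  ((genericPoint_spec X).mem_open_set_iff V.isOpen).2 ⟨x.1, trivial, x.2⟩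

/-- The germ at the generic point of a section over a non-empty open set. -/
def genericGerm (F : X.Modules) {V : X.Opens} (x : V) (s : F.val.obj (op V)) :
    ↑(TopCat.Presheaf.stalk (C := Ab.{u}) F.presheaf (genericPoint X)) :=
  TopCat.Presheaf.germ (C := Ab.{u}) F.presheaf V (genericPoint X) (mem_of_nonempty x) s

lemma genericGerm_add {V : X.Opens} (x : V) (s t : F.val.obj (op V)) :
    genericGerm F x (s + t) = genericGerm F x s + genericGerm F x t :=
  map_add (TopCat.Presheaf.germ (C := Ab.{u}) F.presheaf V (genericPoint X)
    (mem_of_nonempty x)).hom s t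

lemma genericGerm_smul {V : X.Opens} (x : V) (a : Γ(X, V)) (s : F.val.obj (op V)) :
    genericGerm F x (a • s) = (germAt x a : X.functionField) • genericGerm F x s :=
  PresheafOfModules.germ_smul (R := X.presheaf) F.val (genericPoint X) V (mem_of_nonempty x) a s

lemma genericGerm_res {V W : X.Opens} (h : W ≤ V) (x : W) (s : F.val.obj (op V)) :
    genericGerm F x (F.val.restrictₛₗ (homOfLE h).op s) = genericGerm F ⟨x.1, h x.2⟩ s :=
  TopCat.Presheaf.germ_res_apply (C := Ab.{u}) F.presheaf (homOfLE h) _ _ s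

lemma exists_genericGerm_eq
    (z : ↑(TopCat.Presheaf.stalk (C := Ab.{u}) F.presheaf (genericPoint X))) :
    ∃ (V : X.Opens) (x : V) (s : F.val.obj (op V)), genericGerm F x s = z := by
  obtain ⟨V, hV, s, hs⟩ := TopCat.Presheaf.exists_germ_eq (C := Ab.{u}) F.presheaf z
  exact ⟨V, ⟨_, hV⟩, s, hs⟩

/-- Equal germs mean equality on some non-empty open set, and values of sections are constant;
conversely equal values give equal sections on the overlap. -/
lemma genericGerm_eq_iff (G : GenericFiber F.val E) {V W : X.Opens} (x : V) (y : W) (s : F.val.obj (op V))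
    (t : F.val.obj (op W)) : genericGerm F x s = genericGerm F y t ↔ G.val x s = G.val y t := by
  constructor
  · intro h
    obtain ⟨Z, hZ, i, j, hij⟩ := TopCat.Presheaf.germ_eq (C := Ab.{u}) F.presheaf _ _ _ s t h
    have h1 := G.val_res (leOfHom i) ⟨_, hZ⟩ s
    have h2 := G.val_res (leOfHom j) ⟨_, hZ⟩ t
    rw [G.val_eq x ⟨_, leOfHom i hZ⟩, G.val_eq y ⟨_, leOfHom j hZ⟩, ← h1, ← h2]
    exact congrArg _ hij
  · intro h
    obtain ⟨z, hz⟩ := exists_mem_inf x y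
    let z : ↥(V ⊓ W) := ⟨z, hz⟩
    have hst : F.val.restrictₛₗ (homOfLE (inf_le_left : V ⊓ W ≤ V)).op s =
        F.val.restrictₛₗ (homOfLE (inf_le_right : V ⊓ W ≤ W)).op t := by
      refine G.ext _ _ fun w => ?_
      rw [G.val_res, G.val_res, G.val_eq _ x, h]; exact G.val_eq _ _ _
    have h1 := genericGerm_res (F := F) (inf_le_left : V ⊓ W ≤ V) z s
    have h2 := genericGerm_res (F := F) (inf_le_right : V ⊓ W ≤ W) z t
    rw [hst] at h1
    exact h1.symm.trans h2

/-- The generic stalk of a realized sheaf. -/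
lemma nonempty_stalk_equiv (G : GenericFiber F.val E) : Nonempty (E ≃ₗ[X.presheaf.stalk (genericPoint X)]
    ↑(TopCat.Presheaf.stalk (C := Ab.{u}) F.presheaf (genericPoint X))) := by
  choose V hV y s hs using fun e => G.spread e ⊤ ⟨genericPoint X, trivial⟩
  have key : ∀ (W : X.Opens) (z : W) (t : F.val.obj (op W)) (e : E), G.val z t = e →
      genericGerm F z t = genericGerm F (y e) (s e) := fun W z t e he =>
    (genericGerm_eq_iff G _ _ _ _).2 (he.trans (hs e).symm)
  let f : E →ₗ[X.presheaf.stalk (genericPoint X)]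
      ↑(TopCat.Presheaf.stalk (C := Ab.{u}) F.presheaf (genericPoint X)) :=
    { toFun := fun e => genericGerm F (y e) (s e)
      map_add' := fun e f => by
        obtain ⟨z, hz⟩ := exists_mem_inf (y e) (y f)
        let z : ↥(V e ⊓ V f) := ⟨z, hz⟩
        have h1 := G.val_res (inf_le_left : V e ⊓ V f ≤ V e) z (s e)
        have h2 := G.val_res (inf_le_right : V e ⊓ V f ≤ V f) z (s f)
        rw [G.val_eq _ (y e), hs] at h1
        rw [G.val_eq _ (y f), hs] at h2
        rw [← key _ z _ e h1, ← key _ z _ f h2, ← genericGerm_add]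
        exact (key _ z _ _ (by rw [G.val_add, h1, h2])).symm
      map_smul' := fun c e => by
        obtain ⟨W, w, a, ha⟩ := exists_germAt_eq_of_functionField c
        obtain ⟨z, hz⟩ := exists_mem_inf (y e) w
        let z : ↥(V e ⊓ W) := ⟨z, hz⟩
        have h1 := G.val_res (inf_le_left : V e ⊓ W ≤ V e) z (s e)
        rw [G.val_eq _ (y e), hs] at h1
        have h2 := germAt_map (inf_le_right : V e ⊓ W ≤ W) z a
        rw [germAt_eq _ w, ha] at h2
        rw [← key _ z _ e h1, RingHom.id_apply, ← h2, ← genericGerm_smul]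
        refine (key _ z _ _ ?_).symm
        rw [G.val_smul, h1] }
  refine ⟨LinearEquiv.ofBijective f ⟨fun e e' h => ?_, fun z => ?_⟩⟩
  · rw [← hs e, ← hs e', ← genericGerm_eq_iff G]
    exact h
  · obtain ⟨W, x, t, rfl⟩ := exists_genericGerm_eq z
    exact ⟨G.val x t, (key _ x t _ rfl).symm⟩

lemma rank_eq_finrank (G : GenericFiber F.val E) : rank F = Module.finrank X.functionField E :=
  (nonempty_stalk_equiv G).some.finrank_eq.symm

end Rank

end GenericFiber

/-! ### Coherence and reflexivity from codimension-one conditions -/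

section Sheaf
variable {X : Scheme.{u}} [IsIntegral X]

lemma exists_open_forall_not_mem {S : Set (PrimeDivisor X)} (hS : S.Finite) (U : X.Opens) (x : U) :
    ∃ V ≤ U, ∃ _ : V, ∀ P : PrimeDivisor X, P.1 ∈ V → P ∉ S := by
  let O : X.Opens := ⟨(⋃ Q ∈ S, closure {Q.1})ᶜ,
    (hS.isClosed_biUnion fun _ _ => isClosed_closure).isOpen_compl⟩
  have hη : genericPoint X ∈ O := by
    change genericPoint X ∉ _
    simp only [Set.mem_iUnion, not_exists]
    intro Q _ h
    exact Q.ne_genericPoint ((specializes_iff_mem_closure.2 h).antisymm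
      (genericPoint_specializes Q.1)).eq
  refine ⟨U ⊓ O, inf_le_left, ⟨genericPoint X, mem_of_nonempty x, hη⟩, fun P hP hPS => ?_⟩
  exact hP.2 (Set.mem_biUnion hPS (subset_closure rfl))

/-- Needed to see that the `Γ(X, U)`-action on the sheaf transported to `Spec Γ(X, U)` is
multiplication by rational functions. -/
lemma germAt_fromSpec {U : X.Opens} (hU : IsAffineOpen U) (W : (Spec Γ(X, U)).Opens)
    (x : (hU.fromSpec ''ᵁ W : X.Opens)) (y : U) (r : Γ(X, U)) :
    (germAt x ((hU.fromSpec.appIso W).inv ((Spec Γ(X, U)).presheaf.map W.leTop.op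
      ((Scheme.ΓSpecIso Γ(X, U)).inv r))) : X.functionField) = germAt y r := by
  have hle : hU.fromSpec ''ᵁ W ≤ U := by
    refine (hU.fromSpec.image_mono le_top).trans ?_
    rw [Scheme.Hom.image_top_eq_opensRange, hU.opensRange_fromSpec]
  have hle' : W ≤ hU.fromSpec ⁻¹ᵁ U := by rw [hU.fromSpec_preimage_self]; exact le_top
  have h1 := Scheme.Hom.appLE_appIso_inv_apply hU.fromSpec hle' r
  have h2 : hU.fromSpec.appLE U W hle' r = (Spec Γ(X, U)).presheaf.map W.leTop.op
      ((Scheme.ΓSpecIso Γ(X, U)).inv r) := by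
    rw [Scheme.Hom.appLE, hU.fromSpec_app_self, Category.assoc, ← Functor.map_comp]
    rfl
  rw [← h2, h1]
  exact germAt_map hle x r

variable [IsLocallyNoetherian X]

namespace PreWeilDecoration
variable {V : Type u} [AddCommGroup V] [Module X.functionField V] (W : PreWeilDecoration X V)

lemma finite_not_nonneg (v : V) : {P : PrimeDivisor X | ¬ 0 ≤ coeff (W.toFun v) P}.Finite := by
  cases h : W.toFun v with
  | top =>
    refine Set.Finite.subset Set.finite_empty fun P hP => hP ?_
    exact le_top
  | coe D =>
    refine D.support.finite_toSet.subset fun P hP => Finsupp.mem_support_iff.2 fun h0 => hP ?_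
    change (0 : WithTop ℤ) ≤ ((D P : ℤ) : WithTop ℤ)
    rw [h0]; rfl

/-- The section with constant value `v`. -/
def constSection (U : X.Opens) (v : V)
    (h : ∀ P : PrimeDivisor X, P.1 ∈ U → 0 ≤ coeff (W.toFun v) P) : W.sections U :=
  ⟨fun _ => v, fun _ _ => rfl, fun _ P hP => h P hP⟩

/-- The generic fiber of the sheaf associated with a pre-Weil decoration of `V` is `V`. -/
def genericFiber : GenericFiber W.sheaf.val V where
  val {U} x s := (show W.sections U from s).1 x
  val_add _ _ _ := rfl
  val_smul _ _ _ := rfl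
  val_res _ _ _ := rfl
  val_eq {U} x y s := (show W.sections U from s).2.1 x y
  ext s t h := Subtype.ext (funext h)
  spread v U x := by
    obtain ⟨U', hU', y, hy⟩ := exists_open_forall_not_mem (W.finite_not_nonneg v) U x
    exact ⟨U', hU', y, W.constSection U' v fun P hP => not_not.1 (hy P hP), rfl⟩

/-- A decoration has bounded poles with respect to a basis: the coordinates of a section have at most
simple poles, and only along finitely many prime divisors. -/
def HasBoundedPoles : Prop :=
  ∃ (e : Module.Basis (Fin 2) X.functionField V) (S : Set (PrimeDivisor X)), S.Finite ∧
    ∀ (v : V) (P : PrimeDivisor X), 0 ≤ coeff (W.toFun v) P →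
      ∀ i, (P ∉ S → 0 ≤ ordTop P (e.repr v i)) ∧ -1 ≤ ordTop P (e.repr v i)

/-- A decoration is locally trivial in codimension one: near each prime divisor, the sections are the
vectors with regular coordinates in some basis. -/
def IsLocallyTrivial : Prop :=
  ∀ P : PrimeDivisor X, ∃ (U : X.Opens) (_ : P.1 ∈ U) (b : Module.Basis (Fin 2) X.functionField V),
    ∀ Q : PrimeDivisor X, Q.1 ∈ U → ∀ v, 0 ≤ coeff (W.toFun v) Q ↔ ∀ i, 0 ≤ ordTop Q (b.repr v i)

lemma rank_sheaf (hB : W.HasBoundedPoles) : rank W.sheaf = 2 := by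
  obtain ⟨e, -⟩ := hB
  rw [rank_eq_finrank W.genericFiber, Module.finrank_eq_card_basis e, Fintype.card_fin]

/-- The section over an open subset of `Spec Γ(X, U)` as a section over its image in `U`. -/
def ofSpecSection {U : X.Opens} (hU : IsAffineOpen U) (W₀ : (Spec Γ(X, U)).Opens)
    (s : (modulesSpecToSheaf.obj (W.sheaf.restrict hU.fromSpec)).obj.obj (op W₀)) :
    W.sections (hU.fromSpec ''ᵁ W₀) := s

lemma ofSpecSection_smul {U : X.Opens} (hU : IsAffineOpen U) (W₀ : (Spec Γ(X, U)).Opens)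
    (r : Γ(X, U)) (s : (modulesSpecToSheaf.obj (W.sheaf.restrict hU.fromSpec)).obj.obj (op W₀))
    (x : (hU.fromSpec ''ᵁ W₀ : X.Opens)) (y : U) :
    (W.ofSpecSection hU W₀ (r • s)).1 x =
      (germAt y r : X.functionField) • (W.ofSpecSection hU W₀ s).1 x :=
  congrArg (· • (W.ofSpecSection hU W₀ s).1 x) (germAt_fromSpec hU W₀ x y r)

/-- A divisor has finite support, so the sum of the absolute values of its coefficients is a uniform
bound. -/
lemma exists_neg_le_coeff (v : V) : ∃ n : ℕ, ∀ P, ((-n : ℤ) : WithTop ℤ) ≤ coeff (W.toFun v) P := by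
  cases h : W.toFun v with
  | top => exact ⟨0, fun P => le_top⟩
  | coe D =>
    refine ⟨∑ P ∈ D.support, (D P).natAbs, fun P => WithTop.coe_le_coe.2 ?_⟩
    change _ ≤ D P
    by_cases hP : P ∈ D.support
    · have := Finset.single_le_sum (f := fun P => (D P).natAbs) (fun _ _ => Nat.zero_le _) hP
      have h2 : (D P).natAbs ≤ ∑ P ∈ D.support, (D P).natAbs := this
      omega
    · rw [Finsupp.notMem_support_iff.1 hP]
      omega

section Normal
variable [∀ x : X, IsIntegrallyClosed (X.presheaf.stalk x)]

lemma ordTop_sum_nonneg {P : PrimeDivisor X} {ι : Type*} (s : Finset ι) (f : ι → X.functionField)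
    (h : ∀ i ∈ s, 0 ≤ ordTop P (f i)) : 0 ≤ ordTop P (∑ i ∈ s, f i) := by
  classical
  induction s using Finset.induction_on with
  | empty => simp [ordTop_zero]
  | insert a s ha ih =>
    rw [Finset.sum_insert ha]
    refine le_trans (le_min (h a (Finset.mem_insert_self _ _))
      (ih fun i hi => h i (Finset.mem_insert_of_mem hi))) (inf_le_ordTop_add P _ _)

/-- By Hartogs, `l` applied to a section has no poles on its domain and is therefore a regular
function. -/
lemma exists_dualSection (l : V →ₗ[X.functionField] X.functionField) (U : X.Opens)
    (h : ∀ P : PrimeDivisor X, P.1 ∈ U → ∀ v, 0 ≤ coeff (W.toFun v) P → 0 ≤ ordTop P (l v)) :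
    ∃ φ : DualSection W.sheaf.val U, ∀ y : U, W.genericFiber.functional y φ = l := by
  have hex : ∀ (U' : X.Opens) (_ : U' ≤ U) (s : W.sections U'),
      ∃ a : Γ(X, U'), ∀ x : U', germAt x a = l (s.1 x) := by
    intro U' hU' s
    by_cases hne : Nonempty U'
    · obtain ⟨x⟩ := hne
      obtain ⟨a, ha⟩ := exists_germAt_eq (l (s.1 x)) U' fun P hP => h P (hU' hP) _ (s.2.2 x P hP)
      exact ⟨a, fun y => by rw [ha, s.2.1 x y]⟩
    -- Over the empty set the ring of functions is trivial, and `0` is the only choice.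
    · exact ⟨0, fun x => absurd ⟨x⟩ hne⟩
  choose a ha using hex
  let φ : DualSection W.sheaf.val U :=
    { app := fun U' hU' =>
        { toFun := fun s => a U' hU' s
          map_add' := fun s t => section_ext fun x => by
            rw [map_add]
            refine (ha _ _ _ _).trans (((map_add l _ _).trans ?_))
            rw [← ha U' hU' s x, ← ha U' hU' t x]
          map_smul' := fun c s => section_ext fun x => by
            rw [RingHom.id_apply, smul_eq_mul, map_mul]
            refine (ha _ _ _ _).trans (((map_smul l _ _).trans ?_))
            rw [← ha U' hU' s x]
            rfl }
      compat := fun U₁ U₂ h₁ h₂ s => section_ext fun x => by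
        rw [germAt_map h₂ x]
        exact (ha U₁ h₁ s _).trans (ha U₂ (h₂.trans h₁) (W.res h₂ s) x).symm }
  refine ⟨φ, fun y => W.genericFiber.functional_eq_of_forall _ _ _ fun U' hU' x s => ?_⟩
  exact (ha U' hU' s x).symm

/-- Away from `S` sections have regular coordinates. Removing also the poles of the finitely many `l
(e i)` makes `l` regular on sections. -/
lemma exists_functional_eq [CompactSpace X] (hB : W.HasBoundedPoles)
    (l : Module.Dual X.functionField V) (U : X.Opens) (x : U) :
    ∃ U' ≤ U, ∃ (y : U') (φ : DualSection W.sheaf.val U'), W.genericFiber.functional y φ = l := by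
  obtain ⟨e, S, hS, hb⟩ := hB
  have hfin : ∀ i, {P : PrimeDivisor X | ¬ 0 ≤ ordTop P (l (e i))}.Finite := fun i => by
    by_cases h0 : l (e i) = 0
    · refine Set.Finite.subset Set.finite_empty fun P hP => hP ?_
      rw [h0, ordTop_zero]; exact le_top
    · exact (finite_ordTop_ne_zero h0).subset fun P hP h => hP h.ge
  obtain ⟨U', hU', y, hy⟩ := exists_open_forall_not_mem (hS.union (Set.finite_iUnion hfin)) U x
  obtain ⟨φ, hφ⟩ := W.exists_dualSection l U' fun P hP v hv => by
    rw [← e.sum_repr v, map_sum]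
    refine ordTop_sum_nonneg _ _ fun i _ => ?_
    have hPS := hy P hP
    simp only [Set.mem_union, Set.mem_iUnion, Set.mem_ofPred_eq, not_or, not_exists, not_not] at hPS
    rw [map_smul, smul_eq_mul, ordTop_mul]
    exact add_nonneg ((hb v P hv i).1 hPS.1) (hPS.2 i)
  exact ⟨U', hU', y, φ, hφ y⟩

/-- It must be shown that a vector with regular values under all dual sections is itself a section.
At a prime divisor `P` of `U` the coordinates of a local basis are dual sections near `P`, so the
vector has regular coordinates there, which by local triviality is the condition at `P`. -/
lemma bijective_evalDual [CompactSpace X] (hB : W.HasBoundedPoles) (hL : W.IsLocallyTrivial)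
    (U : X.Opens) : Function.Bijective (evalDual (P := W.sheaf.val) U) := by
  have : Module.Finite X.functionField V := by
    obtain ⟨e, -⟩ := hB
    exact Module.Finite.of_basis e
  refine W.genericFiber.bijective_evalDual (W.exists_functional_eq hB) U fun v hv => ?_
  refine ⟨W.constSection U v fun P hP => ?_, fun _ => rfl⟩
  obtain ⟨U', hPU', b, hb⟩ := hL P
  refine (hb P hPU' v).2 fun i => ?_
  obtain ⟨φ, hφ⟩ := W.exists_dualSection (b.coord i) (U ⊓ U') fun Q hQ w hw => (hb Q hQ.2 w).1 hw i
  obtain ⟨a, ha⟩ := hv (U ⊓ U') inf_le_left ⟨P.1, hP, hPU'⟩ φ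
  rw [hφ] at ha
  have := ordTop_germAt_nonneg P ⟨P.1, hP, hPU'⟩ (U := U ⊓ U') ⟨hP, hPU'⟩ a
  rwa [ha] at this

/-- At a prime divisor of `U` outside `D(f)` the order of `f` is at least one, so `f ^ n` absorbs
poles of order at most `n`. -/
lemma exists_pow_smul_nonneg {U : X.Opens} (y : U) (f : Γ(X, U)) (v : V)
    (hv : ∀ P : PrimeDivisor X, P.1 ∈ X.basicOpen f → 0 ≤ coeff (W.toFun v) P) :
    ∃ n : ℕ, ∀ P : PrimeDivisor X, P.1 ∈ U →
      0 ≤ coeff (W.toFun ((germAt y (f ^ n) : X.functionField) • v)) P := by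
  obtain ⟨n, hn⟩ := W.exists_neg_le_coeff v
  refine ⟨n, fun P hP => ?_⟩
  rw [W.smul, map_pow, ordTop_pow]
  by_cases hPf : P.1 ∈ X.basicOpen f
  · exact add_nonneg (nsmul_nonneg (ordTop_germAt_nonneg P y hP f) n) (hv P hPf)
  · have h1 : 1 ≤ ordTop P (germAt y f) := by
      rw [germAt_eq_algebraMap y hP, one_le_ordTop_iff]
      rw [Scheme.mem_basicOpen X f P.1 hP] at hPf
      exact (IsLocalRing.residue_eq_zero_iff _).2 hPf
    have h2 : ((n : ℤ) : WithTop ℤ) ≤ n • ordTop P (germAt y f) := by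
      refine le_trans ?_ (nsmul_le_nsmul_right h1 n)
      rw [nsmul_one]; rfl
    refine le_trans ?_ (add_le_add h2 (hn P))
    rw [← WithTop.coe_add, add_neg_cancel]; rfl

/-- This is quasi-coherence: sections over `D(f)` are sections over `U` localized at `f`. They
extend after multiplication by a power of `f`, and a constant section vanishing on a non-empty
`D(f)` is zero. -/
lemma isLocalizing_sheaf {U : X.Opens} (hU : IsAffineOpen U) (y : U) :
    IsLocalizing (modulesSpecToSheaf.obj (W.sheaf.restrict hU.fromSpec)) := by
  have htop : hU.fromSpec ''ᵁ ⊤ = U := by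
    rw [Scheme.Hom.image_top_eq_opensRange, hU.opensRange_fromSpec]
  intro f
  have hf : hU.fromSpec ''ᵁ PrimeSpectrum.basicOpen f = X.basicOpen f :=
    hU.fromSpec_image_basicOpen f
  refine IsLocalizedModule.Away.mk_of_addCommGroup ?_ ?_ ?_
  · exact Scheme.Modules.isUnit_algebraMap_end_of_le_basicOpen
      (M := W.sheaf.restrict hU.fromSpec) f le_rfl
  · intro s
    let s' := W.ofSpecSection hU _ s
    by_cases hne : ∃ z, z ∈ hU.fromSpec ''ᵁ PrimeSpectrum.basicOpen f
    · obtain ⟨z, hz⟩ := hne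
      obtain ⟨n, hn⟩ := W.exists_pow_smul_nonneg y f (s'.1 ⟨z, hz⟩)
        fun P hP => s'.2.2 ⟨z, hz⟩ P (hf.ge hP)
      refine ⟨n, W.constSection (hU.fromSpec ''ᵁ ⊤) _ fun P hP => hn P (htop.le hP),
        Subtype.ext (funext fun x => ?_)⟩
      refine (W.ofSpecSection_smul hU _ (f ^ n) s x y).trans ?_
      exact congrArg _ (s'.2.1 x ⟨z, hz⟩)
    · exact ⟨0, 0, Subtype.ext (funext fun x => absurd ⟨x.1, x.2⟩ hne)⟩
  · intro s hs
    let s' := W.ofSpecSection hU _ s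
    by_cases hne : ∃ z, z ∈ hU.fromSpec ''ᵁ PrimeSpectrum.basicOpen f
    · obtain ⟨z, hz⟩ := hne
      refine ⟨0, ?_⟩
      rw [pow_zero, one_smul]
      have h0 : s'.1 ⟨z, hU.fromSpec.image_mono le_top hz⟩ = 0 :=
        congrFun (congrArg Subtype.val hs) ⟨z, hz⟩
      exact Subtype.ext (funext fun x => (s'.2.1 x _).trans h0)
    -- If `D(f)` is empty then `f = 0`, and the first power of `f` kills every section.
    · refine ⟨1, Subtype.ext (funext fun x => ?_)⟩
      refine (W.ofSpecSection_smul hU _ (f ^ 1) s x y).trans ?_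
      have hbot : X.basicOpen f = ⊥ := by
        rw [← hf]
        exact Opens.ext (Set.eq_empty_of_forall_notMem fun z hz => hne ⟨z, hz⟩)
      rw [basicOpen_eq_bot_iff] at hbot
      rw [hbot, pow_one, map_zero, zero_smul]
      rfl

/-- Multiply the numerators of uniformizers: for `π = b / c` with `b`, `c` regular, `ord b = 1 + ord
c ≥ 1`. Divisors that miss `U` impose nothing. -/
lemma exists_one_le_ordTop {U : X.Opens} (hU : IsAffineOpen U) (y : U)
    {S : Set (PrimeDivisor X)} (hS : S.Finite) :
    ∃ a : Γ(X, U), a ≠ 0 ∧ ∀ P ∈ S, P.1 ∈ U → 1 ≤ ordTop P (germAt y a) := by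
  have : Nonempty U := ⟨y⟩
  have := functionField_isFractionRing_of_isAffineOpen X U hU
  induction S, hS using Set.Finite.induction_on with
  | empty => exact ⟨1, one_ne_zero, fun P hP => absurd hP (Set.notMem_empty P)⟩
  | @insert P S _ _ ih =>
    obtain ⟨a, ha0, ha⟩ := ih
    by_cases hP : P.1 ∈ U
    · obtain ⟨π, hπ⟩ := exists_ordTop_eq_one P
      obtain ⟨b, c, hc, rfl⟩ := IsFractionRing.div_surjective (A := Γ(X, U)) π
      have hb : 1 ≤ ordTop P (germAt y b) := by
        have hc0 : algebraMap Γ(X, U) X.functionField c ≠ 0 := by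
          rw [Ne, IsFractionRing.to_map_eq_zero_iff (K := X.functionField)]
          exact nonZeroDivisors.ne_zero hc
        have h1 := ordTop_mul P (algebraMap Γ(X, U) X.functionField b /
          algebraMap Γ(X, U) X.functionField c) (algebraMap Γ(X, U) X.functionField c)
        rw [div_mul_cancel₀ _ hc0, hπ] at h1
        refine le_of_le_of_eq ?_ h1.symm
        exact le_add_of_nonneg_right (ordTop_germAt_nonneg P y hP c)
      have hb0 : b ≠ 0 := by
        rintro rfl
        rw [map_zero, zero_div, ordTop_zero] at hπ
        exact absurd hπ (by simp)
      refine ⟨a * b, mul_ne_zero ha0 hb0, fun Q hQ hQU => ?_⟩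
      rw [map_mul, ordTop_mul]
      rcases hQ with rfl | hQ
      · exact le_add_of_nonneg_of_le (ordTop_germAt_nonneg _ y hQU a) hb
      · exact le_add_of_le_of_nonneg (ha Q hQ hQU) (ordTop_germAt_nonneg _ y hQU b)
    · refine ⟨a, ha0, fun Q hQ hQU => ?_⟩
      rcases hQ with rfl | hQ
      · exact absurd hQU hP
      · exact ha Q hQ hQU

/-- If `a` vanishes along the divisors of `S` in `U`, it clears the simple poles of all coordinates
by Hartogs, so the sections embed in the span of the `a⁻¹ e i`. That span is a noetherian module. -/
lemma finite_sections (hB : W.HasBoundedPoles) {U : X.Opens} (hU : IsAffineOpen U) (y : U) :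
    Module.Finite Γ(X, U)
      ((modulesSpecToSheaf.obj (W.sheaf.restrict hU.fromSpec)).obj.obj (op ⊤)) := by
  have htop : hU.fromSpec ''ᵁ ⊤ = U := by
    rw [Scheme.Hom.image_top_eq_opensRange, hU.opensRange_fromSpec]
  have : Nonempty U := ⟨y⟩
  have : IsNoetherianRing Γ(X, U) := IsLocallyNoetherian.component_noetherian ⟨U, hU⟩
  obtain ⟨e, S, hS, hb⟩ := hB
  obtain ⟨a, ha0, ha⟩ := exists_one_le_ordTop hU y hS
  let z : (hU.fromSpec ''ᵁ ⊤ : X.Opens) := ⟨y.1, htop.ge y.2⟩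
  let c : X.functionField := germAt y a
  have hc : c ≠ 0 := fun h => ha0 (germAt_injective y (h.trans (map_zero _).symm))
  let := Module.compHom V (germAt y : Γ(X, U) →+* X.functionField)
  let N : Submodule Γ(X, U) V := Submodule.span Γ(X, U) (Set.range fun i => c⁻¹ • e i)
  have hN : ∀ v : V, (∀ P : PrimeDivisor X, P.1 ∈ U → 0 ≤ coeff (W.toFun v) P) → v ∈ N := by
    intro v hv
    have hreg : ∀ i, ∃ r : Γ(X, U), germAt y r = c * e.repr v i := fun i => by
      obtain ⟨r, hr⟩ := exists_germAt_eq (c * e.repr v i) U fun P hP => by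
        rw [ordTop_mul]
        by_cases hPS : P ∈ S
        · refine le_trans ?_ (add_le_add (ha P hPS hP) (hb v P (hv P hP) i).2)
          exact le_of_eq (by rfl)
        · exact add_nonneg (ordTop_germAt_nonneg P y hP a) ((hb v P (hv P hP) i).1 hPS)
      exact ⟨r, hr y⟩
    choose r hr using hreg
    rw [← e.sum_repr v]
    refine sum_mem fun i _ => ?_
    have : e.repr v i • e i = r i • (c⁻¹ • e i) := by
      change _ = (germAt y (r i) : X.functionField) • (c⁻¹ • e i)
      rw [hr, smul_smul, mul_comm c, mul_assoc, mul_inv_cancel₀ hc, mul_one]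
    rw [this]
    exact N.smul_mem _ (Submodule.subset_span ⟨i, rfl⟩)
  have : Module.Finite Γ(X, U) N := Module.Finite.span_of_finite _ (Set.finite_range _)
  let F : ((modulesSpecToSheaf.obj (W.sheaf.restrict hU.fromSpec)).obj.obj (op ⊤)) →ₗ[Γ(X, U)] N :=
    { toFun := fun s => ⟨(W.ofSpecSection hU ⊤ s).1 z, hN _ fun P hP =>
        (W.ofSpecSection hU ⊤ s).2.2 z P (htop.ge hP)⟩
      map_add' := fun _ _ => rfl
      map_smul' := fun r s => Subtype.ext (W.ofSpecSection_smul hU ⊤ r s z y) }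
  refine Module.Finite.of_injective F fun s t hst => Subtype.ext (funext fun x => ?_)
  exact ((W.ofSpecSection hU ⊤ s).2.1 x z).trans ((congrArg Subtype.val hst).trans
    ((W.ofSpecSection hU ⊤ t).2.1 z x))

lemma isCoherent_sheaf (hB : W.HasBoundedPoles) : IsCoherent W.sheaf := by
  intro x
  obtain ⟨_, ⟨U, hU, rfl⟩, hxU, -⟩ := X.isBasis_affineOpens.exists_subset_of_mem_open
    (Set.mem_univ x) isOpen_univ
  have hU : IsAffineOpen U := hU
  refine ⟨U, hU, hxU, (modulesSpecToSheaf.obj (W.sheaf.restrict hU.fromSpec)).obj.obj (op ⊤),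
    W.finite_sections hB hU ⟨x, hxU⟩, ?_⟩
  have := (isIso_fromTildeΓ_iff_isLocalizing _).2 (W.isLocalizing_sheaf hU ⟨x, hxU⟩)
  exact ⟨(asIso (Scheme.Modules.fromTildeΓ (W.sheaf.restrict hU.fromSpec))).symm⟩

end Normal

end PreWeilDecoration
end Sheaf

/-! ### Decorations twisted by units along finitely many divisors -/

section Twist
variable {X : Scheme.{u}} [IsIntegral X]

/-- The stalk embeds in the function field, so the representative chosen in `value` is unique. -/
lemma value_eq_coe_iff {P : PrimeDivisor X} {f : X.functionField} {c : X.residueField P.1} :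
    value P f = c ↔ ∃ a : X.presheaf.stalk P.1,
      algebraMap _ X.functionField a = f ∧ X.residue P.1 a = c := by
  unfold value
  split_ifs with h
  · rw [WithTop.coe_inj]
    refine ⟨fun hc => ⟨h.choose, h.choose_spec, hc⟩, ?_⟩
    rintro ⟨a, ha, rfl⟩
    rw [IsFractionRing.injective (X.presheaf.stalk P.1) X.functionField
      (h.choose_spec.trans ha.symm)]
  · refine iff_of_false (by simp) fun ⟨a, ha, _⟩ => h ⟨a, ha⟩

variable [IsLocallyNoetherian X]

namespace PreWeilDecoration

section OfCoeff
variable {V : Type u} [AddCommGroup V] [Module X.functionField V]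

open Classical in
/-- The decoration with given coefficients. -/
def ofCoeff (m : PrimeDivisor X → V → WithTop ℤ) (hm : ∀ P v, m P v = ⊤ ↔ v = 0)
    (hfin : ∀ v, v ≠ 0 → {P | m P v ≠ 0}.Finite)
    (hsmul : ∀ (f : X.functionField) (v : V) P, m P (f • v) = ordTop P f + m P v)
    (hadd : ∀ P v w, min (m P v) (m P w) ≤ m P (v + w)) : PreWeilDecoration X V :=
  -- For `v ≠ 0` all coefficients are finite by `hm`, so the default value of `untopD` plays no
  -- role.
  let D : ∀ v : V, v ≠ 0 → WeilDivisor X := fun v hv =>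
    Finsupp.ofSupportFinite (fun P => (m P v).untopD 0)
      ((hfin v hv).subset fun P hP h0 => hP (by
        change (m P v).untopD 0 = 0
        rw [h0]; rfl))
  let F : V → WithTop (WeilDivisor X) := fun v => if hv : v = 0 then ⊤ else (D v hv : WeilDivisor X)
  have hF0 : F 0 = ⊤ := dif_pos rfl
  have hF : ∀ v P, coeff (F v) P = m P v := fun v P => by
    by_cases hv : v = 0
    · rw [hv, hF0, (hm P 0).2 rfl]; rfl
    · have : F v = (D v hv : WeilDivisor X) := dif_neg hv
      rw [this]
      obtain ⟨n, hn⟩ := WithTop.ne_top_iff_exists.1 ((hm P v).not.2 hv)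
      change (((m P v).untopD 0 : ℤ) : WithTop ℤ) = _
      rw [← hn]; rfl
  { toFun := F
    eq_top_iff := fun v => by
      refine ⟨fun h => ?_, fun h => h ▸ hF0⟩
      by_contra hv
      have : F v = (D v hv : WeilDivisor X) := dif_neg hv
      rw [this] at h
      exact absurd h (WithTop.coe_ne_top)
    smul := fun f v P => by rw [hF, hF, hsmul]
    inf_le_add := fun v w => by
      by_cases hv : v = 0
      · rw [hv, hF0, top_inf_eq, zero_add]
      by_cases hw : w = 0
      · rw [hw, hF0, inf_top_eq, add_zero]
      by_cases hvw : v + w = 0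
      · rw [hvw, hF0]; exact le_top
      have h1 : F v = (D v hv : WeilDivisor X) := dif_neg hv
      have h2 : F w = (D w hw : WeilDivisor X) := dif_neg hw
      have h3 : F (v + w) = (D (v + w) hvw : WeilDivisor X) := dif_neg hvw
      have h4 : D v hv ⊓ D w hw ≤ D (v + w) hvw := fun P => by
        have h5 := hadd P v w
        rw [← hF, ← hF, ← hF, h1, h2, h3] at h5
        rw [Finsupp.inf_apply]
        change min ((D v hv P : ℤ) : WithTop ℤ) ((D w hw P : ℤ) : WithTop ℤ) ≤
          ((D (v + w) hvw P : ℤ) : WithTop ℤ) at h5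
        exact_mod_cast h5
      rw [h1, h2, h3]
      exact_mod_cast h4 }

open Classical in
lemma coeff_ofCoeff (m : PrimeDivisor X → V → WithTop ℤ) (hm : ∀ P v, m P v = ⊤ ↔ v = 0)
    (hfin : ∀ v, v ≠ 0 → {P | m P v ≠ 0}.Finite)
    (hsmul : ∀ (f : X.functionField) (v : V) P, m P (f • v) = ordTop P f + m P v)
    (hadd : ∀ P v w, min (m P v) (m P w) ≤ m P (v + w)) (v : V) (P : PrimeDivisor X) :
    coeff ((ofCoeff m hm hfin hsmul hadd).toFun v) P = m P v := by
  by_cases hv : v = 0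
  · rw [hv, (hm P 0).2 rfl]
    exact coeff_zero _ P
  · obtain ⟨n, hn⟩ := WithTop.ne_top_iff_exists.1 ((hm P v).not.2 hv)
    refine (congrArg (coeff · P) (dif_neg hv)).trans ?_
    change (((m P v).untopD 0 : ℤ) : WithTop ℤ) = _
    rw [← hn]; rfl

end OfCoeff
end PreWeilDecoration

/-- The order along `P` on `K²` for which the basis `(t, 1), (1, 0)` has orders `ε` and `0`. -/
def twistedOrd (t : PrimeDivisor X → X.functionField) (ε : PrimeDivisor X → ℤ) (P : PrimeDivisor X)
    (v : X.functionField × X.functionField) : WithTop ℤ :=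
  min (ordTop P (v.1 - t P * v.2)) (ordTop P v.2 + ε P)

/-- Here `x = ord q`, `y = ord (q - t)` and `n = ord g` for a unit `t`; the hypotheses are the
ultrametric inequalities among `q`, `q - t`, `t`. If `y ≥ 1` they force `x = 0`, and otherwise `y =
min x 0`. -/
lemma min_add_right_eq (x y : WithTop ℤ) (n : ℤ) (h1 : min y 0 ≤ x) (h2 : min x 0 ≤ y)
    (h3 : min x y ≤ 0) :
    (1 ≤ y → min (y + n) (n + 1) = min (x + n) n + 1) ∧
      (¬ 1 ≤ y → min (y + n) ((n : WithTop ℤ) + 1) = min (x + n) n) := by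
  cases x with
  | top => cases y with
    | top => simp at h3
    | coe y =>
      norm_cast at *
      simp only [top_add, le_top, min_eq_right] at *
      norm_cast at *
      constructor <;> intro _ <;> omega
  | coe x => cases y with
    | top =>
      norm_cast at *
      simp only [top_add, le_top, min_eq_right, min_eq_left] at *
      norm_cast at *
      constructor
      · intro _; omega
      · simp
    | coe y =>
      norm_cast at *
      constructor <;> intro _ <;> omega

lemma ordTop_neg (P : PrimeDivisor X) (f : X.functionField) : ordTop P (-f) = ordTop P f := by
  have h : ordTop P (-1) = 0 := by
    have := ordTop_of_isUnit P (a := -1) isUnit_one.neg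
    rwa [map_neg, map_one] at this
  rw [← neg_one_mul, ordTop_mul, h, zero_add]

section Normal
variable [∀ x : X, IsIntegrallyClosed (X.presheaf.stalk x)]

lemma inf_le_ordTop_sub (P : PrimeDivisor X) (f g : X.functionField) :
    min (ordTop P f) (ordTop P g) ≤ ordTop P (f - g) := by
  rw [sub_eq_add_neg, ← ordTop_neg P g]
  exact inf_le_ordTop_add P _ _

/-- This identifies the two-case coefficient with a lattice order. For `g ≠ 0` put `q = f / g` and
compare the orders of `q` and `q - t`; for `g = 0` both minima are `ord f`, and the condition `g ≠
0` rules out the convention `f / 0 = 0`. -/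
lemma min_ordTop_sub_mul {P : PrimeDivisor X} {t : X.functionField} (ht : ordTop P t = 0)
    (f g : X.functionField) :
    (g ≠ 0 ∧ 1 ≤ ordTop P (f / g - t) →
      min (ordTop P (f - t * g)) (ordTop P g + 1) = min (ordTop P f) (ordTop P g) + 1) ∧
    (¬ (g ≠ 0 ∧ 1 ≤ ordTop P (f / g - t)) →
      min (ordTop P (f - t * g)) (ordTop P g + 1) = min (ordTop P f) (ordTop P g)) := by
  by_cases hg : g = 0
  · simp [hg, ordTop_zero]
  obtain ⟨q, rfl⟩ : ∃ q, f = q * g := ⟨f / g, (div_mul_cancel₀ _ hg).symm⟩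
  obtain ⟨n, hn⟩ := WithTop.ne_top_iff_exists.1 ((ordTop_eq_top_iff (P := P)).not.2 hg)
  have h1 : min (ordTop P (q - t)) 0 ≤ ordTop P q := by
    have := inf_le_ordTop_add P (q - t) t
    rwa [sub_add_cancel, ht] at this
  have h2 : min (ordTop P q) 0 ≤ ordTop P (q - t) := by
    have := inf_le_ordTop_sub P q t
    rwa [ht] at this
  have h3 : min (ordTop P q) (ordTop P (q - t)) ≤ 0 := by
    have := inf_le_ordTop_sub P q (q - t)
    rwa [sub_sub_cancel, ht] at this
  have := min_add_right_eq _ _ n h1 h2 h3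
  rw [mul_div_cancel_right₀ _ hg, ← sub_mul, ordTop_mul, ordTop_mul, ← hn]
  exact ⟨fun h => this.1 h.2, fun h => this.2 fun h' => h ⟨hg, h'⟩⟩

lemma value_eq_residue_iff {P : PrimeDivisor X} {f : X.functionField} (a : X.presheaf.stalk P.1) :
    value P f = (X.residue P.1 a : X.residueField P.1) ↔
      1 ≤ ordTop P (f - algebraMap _ X.functionField a) := by
  rw [value_eq_coe_iff]
  constructor
  · rintro ⟨b, rfl, hb⟩
    rw [← map_sub, one_le_ordTop_iff, map_sub, hb, sub_self]
  · intro h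
    obtain ⟨b, hb⟩ := ordTop_nonneg_iff.1 (le_trans (by norm_num) h)
    refine ⟨b + a, by rw [map_add, hb, sub_add_cancel], ?_⟩
    rw [← hb, one_le_ordTop_iff] at h
    rw [map_add, h, zero_add]

variable {t : PrimeDivisor X → X.functionField} {ε : PrimeDivisor X → ℤ}
  {S : Set (PrimeDivisor X)}

lemma exists_decoration_twistedOrd [CompactSpace X] (hS : S.Finite) (ht : ∀ P ∉ S, t P = 0)
    (hε : ∀ P ∉ S, ε P = 0) : ∃ W : PreWeilDecoration X (X.functionField × X.functionField),
      ∀ v P, coeff (W.toFun v) P = twistedOrd t ε P v := by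
  refine ⟨PreWeilDecoration.ofCoeff (twistedOrd t ε) ?_ ?_ ?_ ?_,
    PreWeilDecoration.coeff_ofCoeff _ _ _ _ _⟩
  · rintro P ⟨f, g⟩
    have h : ordTop P g + (ε P : WithTop ℤ) = ⊤ ↔ g = 0 := by
      rw [WithTop.add_eq_top, ordTop_eq_top_iff]
      simp
    rw [twistedOrd, min_eq_top, h, ordTop_eq_top_iff, Prod.mk_eq_zero]
    constructor
    · rintro ⟨h1, h2⟩
      exact ⟨by rwa [h2, mul_zero, sub_zero] at h1, h2⟩
    · rintro ⟨rfl, rfl⟩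
      simp
  · rintro ⟨f, g⟩ hv
    -- Order `⊤` is excluded so that the set is finite for `f = 0` too; one of `f`, `g` is nonzero,
    -- which settles the remaining divisors.
    have h1 : ∀ f : X.functionField, {P : PrimeDivisor X | ordTop P f ≠ 0 ∧ ordTop P f ≠ ⊤}.Finite :=
      fun f => by
        by_cases hf : f = 0
        · exact Set.Finite.subset Set.finite_empty fun P hP => hP.2 (by rw [hf, ordTop_zero])
        · exact (finite_ordTop_ne_zero hf).subset fun P hP => hP.1
    refine ((hS.union (h1 f)).union (h1 g)).subset fun P hP => ?_
    by_contra hcon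
    simp only [Set.mem_union, not_or, Set.mem_ofPred_eq, not_and_or, not_not] at hcon
    obtain ⟨⟨hPS, hf⟩, hg⟩ := hcon
    refine hP ?_
    rw [twistedOrd, ht P hPS, hε P hPS, zero_mul, sub_zero, WithTop.coe_zero, add_zero]
    rcases hf with hf | hf
    · rcases hg with hg | hg <;> simp [hf, hg]
    · rcases hg with hg | hg
      · simp [hf, hg]
      · rw [ordTop_eq_top_iff] at hf hg
        exact absurd (Prod.ext hf hg) hv
  · rintro c ⟨f, g⟩ P
    change min (ordTop P (c * f - t P * (c * g))) (ordTop P (c * g) + _) = _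
    rw [mul_left_comm, ← mul_sub, ordTop_mul, ordTop_mul, add_assoc, min_add_add_left]
    rfl
  · rintro P ⟨f, g⟩ ⟨f', g'⟩
    refine le_min ?_ ?_
    · change _ ≤ ordTop P (f + f' - t P * (g + g'))
      have : f + f' - t P * (g + g') = (f - t P * g) + (f' - t P * g') := by ring
      rw [this]
      exact (min_le_min (min_le_left _ _) (min_le_left _ _)).trans (inf_le_ordTop_add P _ _)
    · refine (min_le_min (min_le_right _ _) (min_le_right _ _)).trans ?_
      change min (ordTop P g + _) (ordTop P g' + _) ≤ ordTop P (g + g') + _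
      rw [min_add_add_right]
      gcongr
      exact inf_le_ordTop_add P _ _

/-- The basis `(1, 0)`, `(t, 1)` with the second vector divided by `π`. -/
def twistedBasis {K : Type*} [Field K] (t π : K) (hπ : π ≠ 0) : Module.Basis (Fin 2) K (K × K) :=
  Module.Basis.ofEquivFun
    { toFun := fun v => ![v.1 - t * v.2, π * v.2]
      map_add' := fun v w => by
        ext i; fin_cases i
        · change v.1 + w.1 - t * (v.2 + w.2) = v.1 - t * v.2 + (w.1 - t * w.2)
          ring
        · exact mul_add _ _ _
      map_smul' := fun c v => by
        ext i; fin_cases i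
        · change c * v.1 - t * (c * v.2) = c * (v.1 - t * v.2)
          ring
        · exact mul_left_comm _ _ _
      invFun := fun w => (w 0 + t * (π⁻¹ * w 1), π⁻¹ * w 1)
      left_inv := fun v => by
        refine Prod.ext ?_ ?_
        · change v.1 - t * v.2 + t * (π⁻¹ * (π * v.2)) = v.1
          rw [inv_mul_cancel_left₀ hπ, sub_add_cancel]
        · exact inv_mul_cancel_left₀ hπ _
      right_inv := fun w => by
        ext i; fin_cases i
        · exact add_sub_cancel_right _ _
        · exact mul_inv_cancel_left₀ hπ _ }

lemma forall_twistedBasis_repr {K : Type*} [Field K] {t π : K} (hπ : π ≠ 0) (v : K × K)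
    (p : K → Prop) : (∀ i, p ((twistedBasis t π hπ).repr v i)) ↔
      p (v.1 - t * v.2) ∧ p (π * v.2) := by
  rw [Fin.forall_fin_two]
  rfl

lemma exists_ordTop_eq (P : PrimeDivisor X) {n : ℤ} (hn : n = 0 ∨ n = 1) :
    ∃ π : X.functionField, π ≠ 0 ∧ ordTop P π = n := by
  rcases hn with rfl | rfl
  · exact ⟨1, one_ne_zero, ordTop_one P⟩
  · obtain ⟨π, hπ⟩ := exists_ordTop_eq_one P
    refine ⟨π, ?_, hπ⟩
    rintro rfl
    rw [ordTop_zero] at hπ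
    exact absurd hπ (by simp)

/-- A shear by a regular `t` and a rescaling by a unit preserve the standard lattice; `n` is the
order of the scaling factor. -/
lemma min_ordTop_nonneg_iff {P : PrimeDivisor X} {t : X.functionField} (ht : 0 ≤ ordTop P t)
    {n : WithTop ℤ} (hn : n = 0) (v : X.functionField × X.functionField) :
    0 ≤ min (ordTop P v.1) (ordTop P v.2) ↔
      0 ≤ ordTop P (v.1 - t * v.2) ∧ 0 ≤ n + ordTop P v.2 := by
  have h (hv : 0 ≤ ordTop P v.2) : 0 ≤ ordTop P (t * v.2) := by
    rw [ordTop_mul]; exact add_nonneg ht hv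
  rw [hn, zero_add, le_min_iff]
  refine ⟨fun ⟨h1, h2⟩ => ⟨(le_min h1 (h h2)).trans (inf_le_ordTop_sub P _ _), h2⟩,
    fun ⟨h1, h2⟩ => ⟨?_, h2⟩⟩
  have := inf_le_ordTop_add P (v.1 - t * v.2) (t * v.2)
  rw [sub_add_cancel] at this
  exact (le_min h1 (h h2)).trans this

/-- At `P` itself the basis `(1, 0)`, `π⁻¹ (t P, 1)` with `ord_P π = ε P` describes the lattice by
construction. At all other divisors of a small neighbourhood the lattice is standard, and so is the
one spanned by this basis. -/
lemma isLocallyTrivial_of_twistedOrd [CompactSpace X] (hS : S.Finite) (ht : ∀ P ∉ S, t P = 0)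
    (hε : ∀ P ∉ S, ε P = 0) (hε' : ∀ P, ε P = 0 ∨ ε P = 1)
    {W : PreWeilDecoration X (X.functionField × X.functionField)}
    (hW : ∀ v P, coeff (W.toFun v) P = twistedOrd t ε P v) : W.IsLocallyTrivial := by
  intro P
  obtain ⟨π, hπ0, hπ⟩ := exists_ordTop_eq P (hε' P)
  have hT : {Q : PrimeDivisor X | ¬ 0 ≤ ordTop Q (t P)}.Finite := by
    by_cases h0 : t P = 0
    · refine Set.Finite.subset Set.finite_empty fun Q hQ => hQ ?_
      rw [h0, ordTop_zero]; exact le_top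
    · exact (finite_ordTop_ne_zero h0).subset fun Q hQ h => hQ h.ge
  -- Avoid the other twisted divisors, the poles of `t P`, and the zeros and poles of `π`.
  obtain ⟨U, hPU, hU⟩ := exists_open_avoiding P ((hS.union hT).union (finite_ordTop_ne_zero hπ0))
  refine ⟨U, hPU, twistedBasis (t P) π hπ0, fun Q hQU v => ?_⟩
  rw [hW, forall_twistedBasis_repr (p := fun f => 0 ≤ ordTop Q f), ordTop_mul]
  by_cases hQ : Q = P
  · subst hQ
    rw [twistedOrd, le_min_iff, hπ, add_comm (ordTop Q v.2)]
  · have hQ' := mt (hU Q hQU) hQ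
    simp only [Set.mem_union, not_or, Set.mem_ofPred_eq, not_not] at hQ'
    rw [twistedOrd, ht Q hQ'.1.1, hε Q hQ'.1.1, zero_mul, sub_zero, WithTop.coe_zero, add_zero]
    exact min_ordTop_nonneg_iff hQ'.1.2 hQ'.2 v

lemma neg_one_le_of_nonneg_add {x : WithTop ℤ} {n : ℤ} (hn : n = 0 ∨ n = 1)
    (h : 0 ≤ x + n) : -1 ≤ x := by
  cases x with
  | top => exact le_top
  | coe x =>
    have h1 : (0 : ℤ) ≤ x + n := by exact_mod_cast h
    exact WithTop.coe_le_coe.2 (show (-1 : ℤ) ≤ x by omega)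

/-- From `ord g ≥ -ε` and `f = (f - t g) + t g` with `t` regular, both standard coordinates have
order at least `-1`. -/
lemma hasBoundedPoles_of_twistedOrd (hS : S.Finite) (ht : ∀ P ∉ S, t P = 0)
    (hε : ∀ P ∉ S, ε P = 0) (ht' : ∀ P, 0 ≤ ordTop P (t P)) (hε' : ∀ P, ε P = 0 ∨ ε P = 1)
    {W : PreWeilDecoration X (X.functionField × X.functionField)}
    (hW : ∀ v P, coeff (W.toFun v) P = twistedOrd t ε P v) : W.HasBoundedPoles := by
  -- With `t = 0` and `π = 1` this is the standard basis.
  refine ⟨twistedBasis 0 1 one_ne_zero, S, hS, fun v P hv => ?_⟩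
  refine (forall_twistedBasis_repr one_ne_zero v
    (fun f => (P ∉ S → 0 ≤ ordTop P f) ∧ -1 ≤ ordTop P f)).2 ?_
  rw [hW, twistedOrd, le_min_iff] at hv
  rw [zero_mul, sub_zero, one_mul]
  have h2 := neg_one_le_of_nonneg_add (hε' P) hv.2
  have h1 : -1 ≤ ordTop P (t P * v.2) := by
    rw [ordTop_mul]
    exact le_add_of_nonneg_of_le (ht' P) h2
  have h3 := inf_le_ordTop_add P (v.1 - t P * v.2) (t P * v.2)
  rw [sub_add_cancel] at h3
  refine ⟨⟨fun hP => ?_, (le_min (le_trans ?_ hv.1) h1).trans h3⟩, fun hP => ?_, h2⟩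
  · have := hv.1
    rwa [ht P hP, zero_mul, sub_zero] at this
  · exact WithTop.coe_le_coe.2 (show (-1 : ℤ) ≤ 0 by omega)
  · have := hv.2
    rwa [hε P hP, WithTop.coe_zero, add_zero] at this

/-- On a normal noetherian integral scheme, prescribed units `h i` in the residue fields of finitely
many prime divisors `D i` define a reflexive Weil decoration of rank two. -/
theorem exists_weilDecoration [CompactSpace X] {ι : Type*} [Finite ι] (D : ι → PrimeDivisor X)
    (hD : Function.Injective D) (h : ∀ i, (X.residueField (D i).1)ˣ) :
    ∃ W : PreWeilDecoration X (X.functionField × X.functionField),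
      (∀ (f g : X.functionField) (P : PrimeDivisor X),
        ((∃ i, P = D i ∧ g ≠ 0 ∧ value (D i) (f / g) = (h i : X.residueField (D i).1)) →
          coeff (W.toFun (f, g)) P = min (ordTop P f) (ordTop P g) + 1) ∧
        ((¬ ∃ i, P = D i ∧ g ≠ 0 ∧ value (D i) (f / g) = (h i : X.residueField (D i).1)) →
          coeff (W.toFun (f, g)) P = min (ordTop P f) (ordTop P g))) ∧
      W.IsWeilDecoration ∧ IsReflexive W.sheaf ∧ rank W.sheaf = 2 := by
  classical
  -- Lift each `h i` to the local ring of `D i`. The lift is a unit there, because its residue is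
  -- nonzero.
  choose a ha using fun i => IsLocalRing.residue_surjective (R := X.presheaf.stalk (D i).1)
    (h i : X.residueField (D i).1)
  replace ha : ∀ i, X.residue (D i).1 (a i) = (h i : X.residueField (D i).1) := ha
  let T : ι → X.functionField := fun i => algebraMap _ _ (a i)
  have hT : ∀ i, ordTop (D i) (T i) = 0 := fun i => by
    refine ordTop_of_isUnit (D i) ?_
    by_contra hu
    have := (IsLocalRing.residue_eq_zero_iff (a i)).2 ((IsLocalRing.mem_maximalIdeal _).2 hu)
    exact (h i).ne_zero ((ha i).symm.trans this)
  let t : PrimeDivisor X → X.functionField := Function.extend D T 0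
  let ε : PrimeDivisor X → ℤ := fun P => if P ∈ Set.range D then 1 else 0
  have ht : ∀ P ∉ Set.range D, t P = 0 := fun P hP => Function.extend_apply' _ _ _ hP
  have hε : ∀ P ∉ Set.range D, ε P = 0 := fun P hP => if_neg hP
  have hε' : ∀ P, ε P = 0 ∨ ε P = 1 := fun P => by
    by_cases hP : P ∈ Set.range D
    · exact .inr (if_pos hP)
    · exact .inl (hε P hP)
  have htD : ∀ i, t (D i) = T i := fun i => hD.extend_apply T 0 i
  have ht' : ∀ P, 0 ≤ ordTop P (t P) := fun P => by
    by_cases hP : P ∈ Set.range D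
    · obtain ⟨i, rfl⟩ := hP
      rw [htD, hT]
    · rw [ht P hP, ordTop_zero]; exact le_top
  obtain ⟨W, hW⟩ := exists_decoration_twistedOrd (Set.finite_range D) ht hε
  have hB := hasBoundedPoles_of_twistedOrd (Set.finite_range D) ht hε ht' hε' hW
  have hL := isLocallyTrivial_of_twistedOrd (Set.finite_range D) ht hε hε' hW
  have hcoh := W.isCoherent_sheaf hB
  refine ⟨W, fun f g P => ?_, hcoh, ⟨hcoh, W.bijective_evalDual hB hL⟩, W.rank_sheaf hB⟩
  rw [hW]
  by_cases hP : P ∈ Set.range D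
  · obtain ⟨i, rfl⟩ := hP
    have hiff : (∃ j, D i = D j ∧ g ≠ 0 ∧ value (D j) (f / g) = (h j : X.residueField (D j).1)) ↔
        g ≠ 0 ∧ 1 ≤ ordTop (D i) (f / g - T i) := by
      rw [← value_eq_residue_iff (a i), ha i]
      refine ⟨?_, fun hi => ⟨i, rfl, hi⟩⟩
      rintro ⟨j, hj, h1, h2⟩
      -- Injectivity of `D` ensures that no divisor carries two different conditions.
      obtain rfl := hD hj
      exact ⟨h1, h2⟩
    have hε1 : ε (D i) = 1 := if_pos ⟨i, rfl⟩
    rw [hiff, twistedOrd, htD, hε1]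
    exact min_ordTop_sub_mul (hT i) f g
  · refine ⟨?_, fun _ => ?_⟩
    · rintro ⟨i, rfl, -⟩
      exact absurd ⟨i, rfl⟩ hP
    · rw [twistedOrd, ht P hP, hε P hP, zero_mul, sub_zero, WithTop.coe_zero, add_zero]

end Normal

end Twist

/-! ### Normality of affine toric varieties -/

section Normality
open scoped LaurentPolynomial

/-- The localization embeds in the fraction field, in which `A` is integrally closed. -/
lemma isIntegrallyClosedIn_of_isLocalization {A : Type*} (B : Type*) [CommRing A] [IsDomain A]
    [IsIntegrallyClosed A] [CommRing B] [Algebra A B] {S : Submonoid A} (hS : S ≤ nonZeroDivisors A)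
    [IsLocalization S B] : IsIntegrallyClosedIn A B := by
  refine AlgHom.isIntegrallyClosedIn
    (Localization.mapToFractionRing (FractionRing A) S B hS) ?_ ‹_›
  refine (IsLocalization.lift_injective_iff _).2 fun a b => ?_
  exact ⟨fun h => congrArg _ (IsLocalization.injective _ hS h),
    fun h => congrArg _ (IsFractionRing.injective A (FractionRing A) h)⟩

lemma powers_X_le_nonZeroDivisors (A : Type*) [CommRing A] [IsDomain A] :
    Submonoid.powers (Polynomial.X : Polynomial A) ≤ nonZeroDivisors (Polynomial A) :=
  powers_le_nonZeroDivisors_of_noZeroDivisors Polynomial.X_ne_zero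

lemma isIntegrallyClosed_laurentPolynomial (A : Type*) [CommRing A] [IsDomain A]
    [IsIntegrallyClosed A] : IsIntegrallyClosed A[T;T⁻¹] :=
  isIntegrallyClosed_of_isLocalization (R := Polynomial A) _
    (Submonoid.powers (Polynomial.X : Polynomial A)) (powers_X_le_nonZeroDivisors A)

lemma isIntegrallyClosedIn_laurentPolynomial (A : Type*) [CommRing A] [IsDomain A]
    [IsIntegrallyClosed A] : IsIntegrallyClosedIn (Polynomial A) A[T;T⁻¹] :=
  isIntegrallyClosedIn_of_isLocalization _ (powers_X_le_nonZeroDivisors A)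

lemma coeff_toLaurent_of_neg {A : Type*} [Semiring A] (p : Polynomial A) {i : ℤ} (hi : i < 0) :
    (Polynomial.toLaurent p).coeff i = 0 := by
  induction p using Polynomial.induction_on' with
  | add p q hp hq => rw [map_add, AddMonoidAlgebra.coeff_add, Finsupp.add_apply, hp, hq, add_zero]
  | monomial n a =>
    rw [← Polynomial.C_mul_X_pow_eq_monomial, Polynomial.toLaurent_C_mul_X_pow,
      ← LaurentPolynomial.single_eq_C_mul_T]
    exact Finsupp.single_eq_of_ne (by omega)

variable (k : Type u) [Field k]

/-- Splitting off one coordinate presents the ring as Laurent polynomials over the previous one.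
Being a domain is carried along since the Laurent step needs it. -/
lemma isIntegrallyClosed_addMonoidAlgebra_fin (n : ℕ) :
    IsDomain (AddMonoidAlgebra k (Fin n → ℤ)) ∧
      IsIntegrallyClosed (AddMonoidAlgebra k (Fin n → ℤ)) := by
  induction n with
  | zero =>
    have e := AddMonoidAlgebra.uniqueRingEquiv (R := k) (Fin 0 → ℤ)
    exact ⟨e.toMulEquiv.isDomain _, IsIntegrallyClosed.of_equiv e.symm⟩
  | succ n ih =>
    obtain ⟨_, _⟩ := ih
    have := isIntegrallyClosed_laurentPolynomial (AddMonoidAlgebra k (Fin n → ℤ))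
    let e₁ : (Fin (n + 1) → ℤ) ≃+ ℤ × (Fin n → ℤ) :=
      (Fin.consLinearEquiv ℤ fun _ : Fin (n + 1) => ℤ).symm.toAddEquiv
    have e : AddMonoidAlgebra k (Fin (n + 1) → ℤ) ≃+* (AddMonoidAlgebra k (Fin n → ℤ))[T;T⁻¹] :=
      (AddMonoidAlgebra.mapDomainRingEquiv k e₁).trans AddMonoidAlgebra.curryRingEquiv
    exact ⟨e.toMulEquiv.isDomain _, IsIntegrallyClosed.of_equiv e.symm⟩

variable {M : Type u} [AddCommGroup M]

instance isIntegrallyClosed_addMonoidAlgebra [Module.Free ℤ M] [Module.Finite ℤ M] :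
    IsIntegrallyClosed (AddMonoidAlgebra k M) := by
  have := (isIntegrallyClosed_addMonoidAlgebra_fin k (Module.finrank ℤ M)).2
  exact IsIntegrallyClosed.of_equiv
    (AddMonoidAlgebra.mapDomainRingEquiv k (Module.finBasis ℤ M).equivFun.toAddEquiv).symm

/-- The coaction `x^m ↦ x^m T^{⟨m, n⟩}` of the one-parameter subgroup `n`. -/
def coaction (n : M →ₗ[ℤ] ℤ) : AddMonoidAlgebra k M →+* (AddMonoidAlgebra k M)[T;T⁻¹] :=
  AddMonoidAlgebra.curryRingEquiv.toRingHom.comp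
    (AddMonoidAlgebra.mapDomainRingHom k (n.toAddMonoidHom.prod (AddMonoidHom.id M)))

lemma coaction_single (n : M →ₗ[ℤ] ℤ) (m : M) (a : k) :
    coaction k n (AddMonoidAlgebra.single m a) =
      AddMonoidAlgebra.single (n m) (AddMonoidAlgebra.single m a) := by
  simp [coaction]

/-- Hence a term `x^m` of `x` forces a term of degree `⟨m, n⟩` in the coaction, and a bound on the
degrees bounds `⟨m, n⟩`. -/
lemma coeff_coaction (n : M →ₗ[ℤ] ℤ) (x : AddMonoidAlgebra k M) (m : M) :
    ((coaction k n x).coeff (n m)).coeff m = x.coeff m := by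
  classical
  induction x using AddMonoidAlgebra.induction_linear with
  | zero => simp
  | add x y hx hy => simp [hx, hy]
  | single m' a =>
    rw [coaction_single, AddMonoidAlgebra.coeff_single, AddMonoidAlgebra.coeff_single,
      Finsupp.single_apply, Finsupp.single_apply]
    by_cases h : m' = m
    · subst h; simp
    · rw [if_neg h]
      split_ifs
      · simp [h]
      · simp

variable (σ : PointedCone ℝ (M →ₗ[ℤ] ℝ))

/-- The inclusion of the coordinate ring of an affine toric variety into that of the torus. -/
def toTorus : CoordRing k σ →+* AddMonoidAlgebra k M :=
  AddMonoidAlgebra.mapDomainRingHom k (dualMonoid σ).subtype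

lemma toTorus_single (m : dualMonoid σ) (a : k) :
    toTorus k σ (AddMonoidAlgebra.single m a) = AddMonoidAlgebra.single m.1 a := by
  simp [toTorus]

lemma toTorus_injective : Function.Injective (toTorus k σ) :=
  AddMonoidAlgebra.mapDomain_injective Subtype.val_injective

variable {σ}

/-- The coaction of a one-parameter subgroup `n ∈ σ` has no poles on the coordinate ring. -/
lemma exists_toLaurent_eq_coaction {n : M →ₗ[ℤ] ℤ} (hn : ∀ m ∈ dualMonoid σ, 0 ≤ n m) :
    ∃ ψ : CoordRing k σ →+* Polynomial (AddMonoidAlgebra k M),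
      (algebraMap _ (AddMonoidAlgebra k M)[T;T⁻¹]).comp ψ = (coaction k n).comp (toTorus k σ) := by
  let N : Multiplicative (dualMonoid σ) →* Polynomial (AddMonoidAlgebra k M) :=
    { toFun := fun m => Polynomial.C (AddMonoidAlgebra.single m.toAdd.1 1) *
        Polynomial.X ^ (n m.toAdd.1).toNat
      map_one' := by
        rw [toAdd_one, ZeroMemClass.coe_zero, map_zero, Int.toNat_zero, pow_zero, mul_one,
          ← AddMonoidAlgebra.one_def, map_one]
      map_mul' := fun a b => by
        have ha := hn _ a.toAdd.2
        have hb := hn _ b.toAdd.2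
        have : (n (a * b).toAdd.1).toNat = (n a.toAdd.1).toNat + (n b.toAdd.1).toNat := by
          rw [← Int.toNat_add ha hb, ← map_add]; rfl
        rw [this, pow_add, mul_mul_mul_comm, ← map_mul, AddMonoidAlgebra.single_mul_single, mul_one]
        rfl }
  refine ⟨(AddMonoidAlgebra.lift k _ (dualMonoid σ) N).toRingHom,
    AddMonoidAlgebra.ringHom_ext (fun a => ?_) fun m => ?_⟩
  all_goals
    rw [RingHom.comp_apply, RingHom.comp_apply, toTorus_single, coaction_single,
      LaurentPolynomial.algebraMap_eq_toLaurent]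
  · simp [N]
  · change Polynomial.toLaurent (AddMonoidAlgebra.lift k _ (dualMonoid σ) N _) = _
    rw [AddMonoidAlgebra.lift_single, one_smul]
    refine (Polynomial.toLaurent_C_mul_X_pow _ _).trans ?_
    rw [← LaurentPolynomial.single_eq_C_mul_T, toAdd_ofAdd, Int.toNat_of_nonneg (hn _ m.2)]

lemma mem_range_toTorus {x : AddMonoidAlgebra k M} (hx : ∀ m, x.coeff m ≠ 0 → m ∈ dualMonoid σ) :
    x ∈ (toTorus k σ).range := by
  rw [← AddMonoidAlgebra.sum_coeff_single x]
  refine sum_mem fun m hm => ?_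
  exact ⟨AddMonoidAlgebra.single ⟨m, hx m (Finsupp.mem_support_iff.1 hm)⟩ _, toTorus_single _ _ _ _⟩

variable [Module.Free ℤ M] [Module.Finite ℤ M]

/-- The coordinate ring of an affine toric variety is normal. -/
theorem isIntegrallyClosed_coordRing (hσ : IsRationalPolyhedral σ) :
    IsIntegrallyClosed (CoordRing k σ) := by
  obtain ⟨S, rfl⟩ := hσ
  set σ := PointedCone.hull ℝ (toReal '' (S : Set (M →ₗ[ℤ] ℤ))) with hσ
  let := (toTorus k σ).toAlgebra
  have hinj : Function.Injective (algebraMap (CoordRing k σ) (AddMonoidAlgebra k M)) :=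
    toTorus_injective k σ
  have := (faithfulSMul_iff_algebraMap_injective _ _).2 hinj
  -- For a generator `n` of `σ` the coaction maps the coordinate ring into `k[M][T]`, which is
  -- integrally closed in `k[M][T;T⁻¹]`. So an element integral over the coordinate ring has no
  -- exponent `m` with `⟨m, n⟩ < 0`.
  have : IsIntegrallyClosedIn (CoordRing k σ) (AddMonoidAlgebra k M) := by
    refine isIntegrallyClosedIn_iff.2 ⟨hinj, fun {x} hx => mem_range_toTorus k fun m hm => ?_⟩
    refine mem_dualMonoid_hull.2 fun n hn => ?_
    by_contra hneg
    obtain ⟨ψ, hψ⟩ := exists_toLaurent_eq_coaction k (σ := σ) (n := n)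
      fun m hm => mem_dualMonoid_hull.1 hm n hn
    have := isIntegrallyClosedIn_laurentPolynomial (AddMonoidAlgebra k M)
    have hint : IsIntegral (Polynomial (AddMonoidAlgebra k M)) (coaction k n x) := by
      obtain ⟨p, hp, hpx⟩ := hx
      refine ⟨p.map ψ, hp.map ψ, ?_⟩
      rw [Polynomial.eval₂_map, hψ]
      change Polynomial.eval₂ (toTorus k σ) x p = 0 at hpx
      rw [← Polynomial.hom_eval₂, hpx, map_zero]
    obtain ⟨q, hq⟩ := IsIntegrallyClosedIn.algebraMap_eq_of_integral hint
    rw [LaurentPolynomial.algebraMap_eq_toLaurent] at hq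
    refine hm ?_
    rw [← coeff_coaction k n x m, ← hq, coeff_toLaurent_of_neg q (not_le.1 hneg)]
    rfl
  -- Normality now descends from the torus ring `k[M]`.
  exact .of_isIntegrallyClosed_of_isIntegrallyClosedIn _ (AddMonoidAlgebra k M)

end Normality

lemma isIntegrallyClosed_stalk_spec (R : CommRingCat.{u}) [IsDomain R] [IsIntegrallyClosed R]
    (y : Spec R) : IsIntegrallyClosed ((Spec R).presheaf.stalk y) := by
  let : Algebra R ((Spec R).presheaf.stalk y) := StructureSheaf.stalkAlgebra R y
  have : IsLocalization.AtPrime ((Spec R).presheaf.stalk y)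
      (show PrimeSpectrum R from y).asIdeal := StructureSheaf.IsLocalization.to_stalk R y
  exact isIntegrallyClosed_of_isLocalization (R := R) _
    (show PrimeSpectrum R from y).asIdeal.primeCompl (Ideal.primeCompl_le_nonZeroDivisors _)

lemma isIntegrallyClosed_stalk_of_isOpenImmersion {X Y : Scheme.{u}} (f : X ⟶ Y) [IsOpenImmersion f]
    (x : X) [IsIntegrallyClosed (X.presheaf.stalk x)] :
    IsIntegrallyClosed (Y.presheaf.stalk (f x)) :=
  IsIntegrallyClosed.of_equiv (asIso (f.stalkMap x)).commRingCatIsoToRingEquiv.symm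

/-- Restriction of a section extended along an open immersion. -/
lemma map_appIso_inv {A B X : Scheme.{u}} (f : A ⟶ B) (g : B ⟶ X) [IsOpenImmersion g] {h : A ⟶ X}
    [IsOpenImmersion h] (w : f ≫ g = h) (hle : h ''ᵁ ⊤ ≤ g ''ᵁ ⊤) (s : Γ(B, ⊤)) :
    X.presheaf.map (homOfLE hle).op ((g.appIso ⊤).inv s) = (h.appIso ⊤).inv (f.appTop s) := by
  subst w
  have e : (⊤ : A.Opens) ≤ (f ≫ g) ⁻¹ᵁ (g ''ᵁ ⊤) := by
    rw [Scheme.Hom.comp_preimage, Scheme.Hom.preimage_image_eq]; exact le_top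
  have h1 := Scheme.Hom.appLE_appIso_inv (f ≫ g) e
  have h2 : (g.appIso ⊤).inv ≫ (f ≫ g).appLE (g ''ᵁ ⊤) ⊤ e = f.appTop := by
    rw [Scheme.Hom.comp_appLE, Scheme.Hom.appIso_inv_app_assoc]
    exact (Scheme.Hom.map_appLE f _ _).trans (Scheme.Hom.appLE_eq_app f)
  rw [← h2, ← ConcreteCategory.comp_apply, ← ConcreteCategory.comp_apply, Category.assoc, h1]

variable {M : Type u} [AddCommGroup M]

/-! ### Rays and their primitive generators -/

section Ray

lemma exists_apply_eq_of_mem_rayCone {n : M →ₗ[ℤ] ℤ} {v : M →ₗ[ℤ] ℝ} (hv : v ∈ rayCone n)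
    (hv0 : v ≠ 0) : ∃ c : ℝ, 0 < c ∧ ∀ m, v m = c * n m := by
  obtain ⟨c, rfl⟩ := Submodule.mem_span_singleton.1 hv
  refine ⟨c.1, lt_of_le_of_ne c.2 fun h => hv0 ?_, fun m => rfl⟩
  have : c = 0 := Subtype.ext h.symm
  rw [this, zero_smul]

/-- The common vector gives `c n = c' n'` with `c, c' > 0`. Evaluating where `n`, respectively `n'`,
takes the value `1` yields `n'(m) n(m') = 1` in integers, so `c = c'`. -/
lemma eq_of_mem_rayCone {n n' : M →ₗ[ℤ] ℤ} (hn : IsPrimitive n) (hn' : IsPrimitive n')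
    {v : M →ₗ[ℤ] ℝ} (hv0 : v ≠ 0) (hv : v ∈ rayCone n) (hv' : v ∈ rayCone n') : n = n' := by
  obtain ⟨c, hc, h⟩ := exists_apply_eq_of_mem_rayCone hv hv0
  obtain ⟨c', hc', h'⟩ := exists_apply_eq_of_mem_rayCone hv' hv0
  have key : ∀ m, c * n m = c' * n' m := fun m => (h m).symm.trans (h' m)
  obtain ⟨m, hm⟩ := hn.exists_apply_eq_one
  obtain ⟨m', hm'⟩ := hn'.exists_apply_eq_one
  have k1 := key m
  have k2 := key m'
  rw [hm, Int.cast_one, mul_one] at k1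
  rw [hm', Int.cast_one, mul_one] at k2
  have hpos : 0 < n' m := by
    have : 0 < c' * (n' m : ℝ) := k1 ▸ hc
    exact_mod_cast (pos_iff_pos_of_mul_pos this).1 hc'
  have hprod : (n' m) * (n m') = 1 := by
    have : c * ((n' m : ℝ) * n m') = c * 1 := by linear_combination (n' m : ℝ) * k2 - k1
    exact_mod_cast mul_left_cancel₀ hc.ne' this
  have h1 : n' m = 1 := Int.eq_one_of_mul_eq_one_right hpos.le hprod
  rw [h1, Int.cast_one, mul_one] at k1
  ext l
  have := key l
  rw [k1] at this
  exact_mod_cast mul_left_cancel₀ hc'.ne' this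

lemma IsPrimitive.toReal_ne_zero {n : M →ₗ[ℤ] ℤ} (hn : IsPrimitive n) : toReal n ≠ 0 := by
  obtain ⟨m, hm⟩ := hn.exists_apply_eq_one
  intro h
  have := LinearMap.congr_fun h m
  simp [hm] at this

instance finite_ray (Δ : Fan M) : Finite Δ.Ray := by
  have := Δ.finite.to_subtype
  refine Finite.of_injective (Fan.Ray.cone (Δ := Δ)) fun ρ ρ' h => Subtype.ext ?_
  have hmem : toReal ρ.1 ∈ rayCone ρ.1 := Submodule.subset_span rfl
  have hcone : rayCone ρ.1 = rayCone ρ'.1 := congrArg Subtype.val h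
  exact eq_of_mem_rayCone ρ.2.1 ρ'.2.1 ρ.2.1.toReal_ne_zero hmem (hcone ▸ hmem)

end Ray

/-! ### Geometry of the toric variety along its rays -/

section Toric
variable (k : Type u) [Field k] (Δ : Fan M)

instance compactSpace_toricVariety : CompactSpace (toricVariety k Δ) := by
  have := Δ.finite.to_subtype
  refine ⟨?_⟩
  have : (Set.univ : Set (toricVariety k Δ)) = ⋃ σ, Set.range (chart k Δ σ) :=
    (Set.eq_univ_of_forall fun x => by
      obtain ⟨σ, y, rfl⟩ := exists_chart k Δ x
      exact Set.mem_iUnion.2 ⟨σ, y, rfl⟩).symm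
  rw [this]
  exact isCompact_iUnion fun σ => isCompact_range (chart k Δ σ).continuous

lemma isUnit_chi {σ : PointedCone ℝ (M →ₗ[ℤ] ℝ)} (m : dualMonoid σ)
    (hm : -(m : M) ∈ dualMonoid σ) : IsUnit (chi k σ m) := by
  refine IsUnit.of_mul_eq_one (chi k σ ⟨_, hm⟩) ?_
  rw [chi_mul, AddMonoidAlgebra.one_def]
  congr 1
  exact Subtype.ext (add_neg_cancel _)

/-- An element of the coordinate ring of `U_σ` as a section of the structure sheaf of `X`. -/
def chartSection (σ : Δ.cones) : CoordRing k σ.1 →+*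
    Γ(toricVariety k Δ, chart k Δ σ ''ᵁ ⊤) :=
  ((Scheme.ΓSpecIso (.of (CoordRing k σ.1))).inv ≫ ((chart k Δ σ).appIso ⊤).inv).hom

lemma image_chart_le {σ τ : Δ.cones} (h : τ.1 ≤ σ.1) :
    chart k Δ τ ''ᵁ ⊤ ≤ chart k Δ σ ''ᵁ ⊤ := by
  rintro _ ⟨y, -, rfl⟩
  refine ⟨chartMap k h y, trivial, ?_⟩
  exact (Scheme.Hom.comp_apply _ _ y).symm.trans
    (congrArg (fun f : affineChart k τ.1 ⟶ _ => f y) (chartMap_chart k Δ h))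

lemma map_chartSection {σ τ : Δ.cones} (h : τ.1 ≤ σ.1) (r : CoordRing k σ.1) :
    (toricVariety k Δ).presheaf.map (homOfLE (image_chart_le k Δ h)).op (chartSection k Δ σ r) =
      chartSection k Δ τ (coordMap k h r) := by
  refine (map_appIso_inv (chartMap k h) (chart k Δ σ) (chartMap_chart k Δ h)
    (image_chart_le k Δ h) _).trans ?_
  exact congrArg ((chart k Δ τ).appIso ⊤).inv (ConcreteCategory.congr_hom
    (Scheme.ΓSpecIso_inv_naturality (CommRingCat.ofHom (coordMap k h))) r).symm

variable [Module.Free ℤ M] [Module.Finite ℤ M]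

instance isIntegrallyClosed_stalk_toricVariety (x : toricVariety k Δ) :
    IsIntegrallyClosed ((toricVariety k Δ).presheaf.stalk x) := by
  obtain ⟨σ, y, rfl⟩ := exists_chart k Δ x
  have : IsIntegrallyClosed (CoordRing k σ.1) := isIntegrallyClosed_coordRing k (Δ.rational _ σ.2)
  have := isIntegrallyClosed_stalk_spec (.of (CoordRing k σ.1)) y
  exact isIntegrallyClosed_stalk_of_isOpenImmersion (chart k Δ σ) y

/-- If `τ` were zero, a monomial `x^m` with `⟨m, n⟩ = 1` would be invertible on `U_τ`; but it
vanishes at the orbit point. -/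
lemma exists_ne_zero_mem_of_chartMap_eq_orbitPoint {n : M →ₗ[ℤ] ℤ} (hn : IsPrimitive n)
    {τ : PointedCone ℝ (M →ₗ[ℤ] ℝ)} (h : τ ≤ rayCone n) {z : affineChart k τ}
    (hz : chartMap k h z = orbitPoint k n) : ∃ v ∈ τ, v ≠ 0 := by
  by_contra! hτ
  obtain ⟨m, hm⟩ := hn.exists_apply_eq_one
  have hmn : m ∈ dualMonoid (rayCone n) := mem_dualMonoid_rayCone.2 (by omega)
  have h1 : chi k (rayCone n) ⟨m, hmn⟩ ∈ orbitIdeal k n :=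
    Ideal.subset_span ⟨⟨m, hmn⟩, by change 0 < n m; omega, rfl⟩
  have h2 : chi k (rayCone n) ⟨m, hmn⟩ ∈
      (show PrimeSpectrum (CoordRing k (rayCone n)) from chartMap k h z).asIdeal := by
    rw [hz]; exact h1
  have h3 : coordMap k h (chi k (rayCone n) ⟨m, hmn⟩) ∈
    (show PrimeSpectrum (CoordRing k τ) from z).asIdeal := h2
  rw [coordMap_single] at h3
  refine (show PrimeSpectrum (CoordRing k τ) from z).2.ne_top (Ideal.eq_top_of_isUnit_mem _ h3 ?_)
  exact isUnit_chi k ⟨m, dualMonoid_anti h hmn⟩ fun v hv => by rw [hτ v hv]; exact le_rfl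

/-- If two divisors have the same generic point, it comes from a chart `U_τ` with `τ` contained in
both rays. Then `τ ≠ 0`, so the rays share a nonzero vector. -/
lemma rayDivisor_injective : Function.Injective (rayDivisor k (Δ := Δ)) := by
  intro ρ ρ' h
  obtain ⟨τ, f, f', z, hz, hz'⟩ := (Scheme.IsLocallyDirected.ι_eq_ι_iff (chartFunctor k Δ)).1
    (congrArg Subtype.val h : chart k Δ ρ.cone (orbitPoint k ρ.1) =
      chart k Δ ρ'.cone (orbitPoint k ρ'.1))
  obtain ⟨v, hv, hv0⟩ := exists_ne_zero_mem_of_chartMap_eq_orbitPoint k ρ.2.1 (leOfHom f) hz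
  exact Subtype.ext (eq_of_mem_rayCone ρ.2.1 ρ'.2.1 hv0 (leOfHom f hv) (leOfHom f' hv))

/-- A monomial of degree zero along a ray is a unit at the divisor of the ray. -/
lemma exists_isUnit_algebraMap_eq_monomial (ρ : Δ.Ray) {m : M} (hm : ρ.1 m = 0) :
    ∃ a : (toricVariety k Δ).presheaf.stalk (rayDivisor k ρ).1, IsUnit a ∧
      algebraMap _ (toricVariety k Δ).functionField a = monomial k Δ m := by
  have hmρ : m ∈ dualMonoid ρ.cone.1 := mem_dualMonoid_rayCone.2 hm.ge
  have hmρ' : -m ∈ dualMonoid ρ.cone.1 := mem_dualMonoid_rayCone.2 (by rw [map_neg, hm, neg_zero])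
  have h0 : Δ.zeroCone.1 ≤ ρ.cone.1 := bot_le
  let U := chart k Δ ρ.cone ''ᵁ ⊤
  let s : Γ(toricVariety k Δ, U) := chartSection k Δ ρ.cone (chi k _ ⟨m, hmρ⟩)
  have hs : IsUnit s := (isUnit_chi k (σ := ρ.cone.1) ⟨m, hmρ⟩ hmρ').map _
  have hD : (rayDivisor k ρ).1 ∈ U := ⟨orbitPoint k ρ.1, trivial, rfl⟩
  have : Nonempty U := ⟨⟨_, hD⟩⟩
  refine ⟨(toricVariety k Δ).presheaf.germ U _ hD s, hs.map _, ?_⟩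
  rw [← germToFunctionField_eq_algebraMap hD]
  -- Restricted to the torus chart, the section is the monomial by which `monomial` is defined.
  have h1 : (toricVariety k Δ).presheaf.map (homOfLE (image_chart_le k Δ h0)).op s =
      chartSection k Δ Δ.zeroCone (chi k _ ⟨m, dualMonoid_anti h0 hmρ⟩) := by
    rw [map_chartSection k Δ h0, coordMap_single]
  rw [monomial]
  refine Eq.trans ?_ (congrArg _ h1)
  exact (TopCat.Presheaf.germ_res_apply (toricVariety k Δ).presheaf
    (homOfLE (image_chart_le k Δ h0)) _ _ s).symm

end Toric

end

end WeilDeco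

/-! ### The theorem -/

theorem theoremC (k : Type u) [Field k] [IsAlgClosed k] [CharZero k]
    {M : Type u} [AddCommGroup M] [Module.Free ℤ M] [Module.Finite ℤ M] (Δ : WeilDeco.Fan M) :
    let X := WeilDeco.toricVariety k Δ
    let K := X.functionField
    (∀ h : ∀ ρ : Δ.Ray, (X.residueField (WeilDeco.rayDivisor k ρ).1)ˣ,
      ∃ W : WeilDeco.PreWeilDecoration X (K × K),
        (∀ (f g : K) (P : WeilDeco.PrimeDivisor X),
          ((∃ ρ : Δ.Ray, P = WeilDeco.rayDivisor k ρ ∧ g ≠ 0 ∧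
              WeilDeco.value (WeilDeco.rayDivisor k ρ) (f / g) =
                (h ρ : X.residueField (WeilDeco.rayDivisor k ρ).1)) →
            WeilDeco.coeff (W.toFun (f, g)) P =
              min (WeilDeco.ordTop P f) (WeilDeco.ordTop P g) + 1) ∧
          ((¬ ∃ ρ : Δ.Ray, P = WeilDeco.rayDivisor k ρ ∧ g ≠ 0 ∧
              WeilDeco.value (WeilDeco.rayDivisor k ρ) (f / g) =
                (h ρ : X.residueField (WeilDeco.rayDivisor k ρ).1)) →
            WeilDeco.coeff (W.toFun (f, g)) P =
              min (WeilDeco.ordTop P f) (WeilDeco.ordTop P g))) ∧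
        W.IsWeilDecoration ∧ WeilDeco.IsReflexive W.sheaf ∧ WeilDeco.rank W.sheaf = 2) ∧
    (∀ u : (Δ.Ray →₀ ℤ) →ₗ[ℤ] M, (∀ ρ : Δ.Ray, ρ.1 (u (Finsupp.single ρ 1)) = 0) →
      ∃ W : WeilDeco.PreWeilDecoration X (K × K),
        (∀ (f g : K) (P : WeilDeco.PrimeDivisor X),
          ((∃ ρ : Δ.Ray, P = WeilDeco.rayDivisor k ρ ∧ g ≠ 0 ∧
              WeilDeco.value (WeilDeco.rayDivisor k ρ) (f / g) =
              WeilDeco.value (WeilDeco.rayDivisor k ρ) (WeilDeco.monomial k Δ (u (Finsupp.single ρ 1)))) →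
            WeilDeco.coeff (W.toFun (f, g)) P =
              min (WeilDeco.ordTop P f) (WeilDeco.ordTop P g) + 1) ∧
          ((¬ ∃ ρ : Δ.Ray, P = WeilDeco.rayDivisor k ρ ∧ g ≠ 0 ∧
              WeilDeco.value (WeilDeco.rayDivisor k ρ) (f / g) =
              WeilDeco.value (WeilDeco.rayDivisor k ρ) (WeilDeco.monomial k Δ (u (Finsupp.single ρ 1)))) →
            WeilDeco.coeff (W.toFun (f, g)) P =
              min (WeilDeco.ordTop P f) (WeilDeco.ordTop P g))) ∧
        W.IsWeilDecoration ∧ WeilDeco.IsReflexive W.sheaf ∧ WeilDeco.rank W.sheaf = 2) := by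
  intro X K
  have part_i := WeilDeco.exists_weilDecoration (WeilDeco.rayDivisor k (Δ := Δ))
    (WeilDeco.rayDivisor_injective k Δ)
  refine ⟨part_i, fun u hu => ?_⟩
  choose a ha ha' using fun ρ : Δ.Ray =>
    WeilDeco.exists_isUnit_algebraMap_eq_monomial k Δ ρ (hu ρ)
  -- The value of `x^{u_ρ}` at `D_ρ` is the residue of a unit, so it is an admissible `h(ρ)` for
  -- part (i).
  have hval : ∀ ρ : Δ.Ray, WeilDeco.value (WeilDeco.rayDivisor k ρ)
      (WeilDeco.monomial k Δ (u (Finsupp.single ρ 1))) =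
      (((ha ρ).map (X.residue (WeilDeco.rayDivisor k ρ).1).hom).unit :
        X.residueField (WeilDeco.rayDivisor k ρ).1) :=
    fun ρ => WeilDeco.value_eq_coe_iff.2 ⟨a ρ, ha' ρ, rfl⟩
  simp only [hval]
  exact part_i _
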